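/- Let $\Omega\subset\mathbb R^2$ be a strictly convex domain with $C^3$ boundary of positive curvature and boundary length $l$, and let $\gamma:\mathbb R/l\mathbb Z\to\partial\Omega$ be the counterclockwise arc-length parametrization. Its billiard map $f$ acts on the closed annulus $\mathbb R/l\mathbb Z\times[0,\pi]$: for $0<\varphi<\pi$, $f(s,\varphi)=(s',\varphi')$, where $\gamma(s')$ is the point at which the ray from $\gamma(s)$ that makes the angle $\varphi$ with $\gamma'(s)$ meets $\partial\Omega$ again, and $\varphi'$ is the angle between $\gamma'(s')$ and the direction reflected at $\gamma(s')$ according to the law of reflection; moreover $f(s,0)=(s,0)$ and $f(s,\pi)=(s,\pi)$. The billiard maps $f$ of $\Omega_f$ and $g$ of $\Omega_g$ are called *$C^0$-conjugate near the boundary* if there are a homeomorphism $h$ from an open neighbourhood $U$ of the circle $\{\varphi=0\}$ in the closed annulus of $f$ onto an open neighbourhood $V$ of the circle $\{\varphi=0\}$ in the closed annulus of $g$, and a $\delta>0$, such that $h(U\cap\{\varphi=0\})=V\cap\{\varphi=0\}$ and, for all $(s,\varphi)$ with $0\le\varphi\le\delta$, both $(s,\varphi)$ and $f(s,\varphi)$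 lie in $U$ and $h(f(s,\varphi))=g(h(s,\varphi))$. The billiard in $\Omega$ is called *integrable near the boundary* if a neighbourhood of the boundary is foliated by a $C^1$ family of invariant curves that are graphs over the boundary, in the following sense: for some $0<\delta<\pi$ there is a continuous function $F:\mathbb R/l\mathbb Z\times[0,\delta)\to\mathbb R$, constant on $\{\varphi=0\}$ and of class $C^1$ with $\partial F/\partial\varphi\neq0$ on $\{0<\varphi<\delta\}$, such that $F(f(s,\varphi))=F(s,\varphi)$ whenever both $(s,\varphi)$ and $f(s,\varphi)$ lie in $\mathbb R/l\mathbb Z\times[0,\delta)$. **Proposition.** (i) If $\partial\Omega_f$ is a circle and $\partial\Omega_g$ is an ellipse of non-zero eccentricity, then the billiard maps of $\Omega_f$ and $\Omega_g$ are $C^0$-conjugate near the boundary. (ii) If $\partial\Omega_f$ and $\partial\Omega_g$ are ellipses of different eccentricities, then the billiard maps of $\Omega_f$ and $\Omega_g$ are $C^0$-conjugate near the boundary. (iii) If the billiards in $\Omega_f$ and $\Omega_g$ are both integrable near the boundary, then the billiard maps of $\Omega_f$ and $\Omega_g$ are $C^0$-conjugate near the boundary. -/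

import Mathlib

/-- A strictly convex planar domain with `C³` boundary, given (as usual for billiards) by the
counterclockwise arc-length parametrization `γ` of its boundary; the plane is `ℂ`.
For `a b : ℂ`, the number `(conj a * b).im` is the cross product `a × b`.
"Strictly convex" comprises positive curvature of the boundary. -/
structure StrictlyConvexTable where
  /-- the length of the boundary -/
  length : ℝ
  length_pos : 0 < length
  /-- the arc-length parametrization of the boundary -/
  γ : ℝ → ℂ
  periodic : Function.Periodic γ length
  contDiff : ContDiff ℝ 3 γ
  unit_speed : ∀ s : ℝ, ‖deriv γ s‖ = 1
  /-- The signed curvature `γ' × γ''` is positive. -/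
  curvature_pos : ∀ s : ℝ, 0 < ((starRingEnd ℂ) (deriv γ s) * deriv (deriv γ) s).im
  /-- Strict convexity: the boundary lies strictly to the left of each of its oriented tangent
  lines, the point of tangency excepted. In particular the boundary is a simple closed curve,
  traversed once, and `i γ'` is the inner normal. -/
  strictly_left : ∀ s t : ℝ, (∀ n : ℤ, t ≠ s + n * length) →
    0 < ((starRingEnd ℂ) (deriv γ s) * (γ t - γ s)).im

namespace StrictlyConvexTable

theorem periodic_deriv (D : StrictlyConvexTable) :
    Function.Periodic (deriv D.γ) D.length := by
  intro s
  have h : (fun x => D.γ (x + D.length)) = D.γ := funext D.periodic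
  rw [← deriv_comp_add_const, h]

/-- The boundary curve, as a subset of the plane. -/
def boundary (D : StrictlyConvexTable) : Set ℂ := Set.range D.γ

/-- The boundary point with arc-length coordinate `s`. -/
def point (D : StrictlyConvexTable) : AddCircle D.length → ℂ := D.periodic.lift

/-- The positive unit tangent at the boundary point with arc-length coordinate `s`. -/
noncomputable def tangent (D : StrictlyConvexTable) : AddCircle D.length → ℂ :=
  D.periodic_deriv.lift

/-- The closed phase annulus `(ℝ / lℤ) × [0, π]`. The pair `(s, φ)` stands for the unit vector at
the boundary point `s` that makes the angle `φ` with the positive tangent. -/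
abbrev Phase (D : StrictlyConvexTable) : Type :=
  AddCircle D.length × Set.Icc (0 : ℝ) Real.pi

/-- The vector of `p` points along the chord from its foot point to the foot point of `q`, and the
vector of `q` is the reflection of that direction in the tangent line at the foot point of `q`:
the incoming direction makes the angle `-φ'` with the positive tangent there, the outgoing one
the angle `φ'`. -/
def Bounce (D : StrictlyConvexTable) (p q : D.Phase) : Prop :=
  ∃ r : ℝ, 0 < r ∧
    D.point q.1 - D.point p.1
      = r * (Complex.exp ((p.2 : ℝ) * Complex.I) * D.tangent p.1) ∧
    D.point q.1 - D.point p.1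
      = r * (Complex.exp (-((q.2 : ℝ) * Complex.I)) * D.tangent q.1)

open Classical in
/-- The billiard map on the closed annulus: for `0 < φ < π` the next bounce (which exists and is
unique), and the identity on the two boundary circles `φ = 0` and `φ = π`. -/
noncomputable def billiardMap (D : StrictlyConvexTable) (p : D.Phase) : D.Phase :=
  if h : (0 < (p.2 : ℝ) ∧ (p.2 : ℝ) < Real.pi) ∧ ∃ q, D.Bounce p q then h.2.choose else p

/-- The boundary is a circle. -/
def IsCircle (D : StrictlyConvexTable) : Prop :=
  ∃ (c : ℂ) (R : ℝ), 0 < R ∧ D.boundary = Metric.sphere c R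

/-- The boundary is an ellipse of eccentricity `e`, with foci `p` and `q` and major axis `2a`. -/
def IsEllipse (D : StrictlyConvexTable) (e : ℝ) : Prop :=
  0 ≤ e ∧ e < 1 ∧ ∃ (p q : ℂ) (a : ℝ), 0 < a ∧ dist p q = 2 * a * e ∧
    D.boundary = {z : ℂ | dist z p + dist z q = 2 * a}

/-- Integrability near the boundary: a collar `0 ≤ φ < δ` of the boundary circle `φ = 0` is
foliated by the level curves of an integral of motion `F`. The boundary circle is itself a level
curve, and the others form a `C¹` family of `C¹` graphs over the boundary (`F` is `C¹` with
`∂F/∂φ ≠ 0` for `0 < φ < δ`), like the invariant curves that belong to a family of convex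
caustics. No differentiability is asked for on `φ = 0` itself. `F` is written as a function of
`(s, φ)`, periodic in `s`. -/
def IntegrableNearBoundary (D : StrictlyConvexTable) : Prop :=
  ∃ (δ : ℝ) (F : ℝ × ℝ → ℝ), 0 < δ ∧ δ < Real.pi ∧
    (∀ s φ : ℝ, F (s + D.length, φ) = F (s, φ)) ∧
    ContinuousOn F {x : ℝ × ℝ | 0 ≤ x.2 ∧ x.2 < δ} ∧
    ContDiffOn ℝ 1 F {x : ℝ × ℝ | 0 < x.2 ∧ x.2 < δ} ∧
    (∀ s φ : ℝ, 0 < φ → φ < δ → deriv (fun ψ : ℝ => F (s, ψ)) φ ≠ 0) ∧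
    (∀ s : ℝ, F (s, 0) = F (0, 0)) ∧
    (∀ (s s' : ℝ) (φ φ' : Set.Icc (0 : ℝ) Real.pi), (φ : ℝ) < δ → (φ' : ℝ) < δ →
      D.billiardMap ((s : AddCircle D.length), φ) = ((s' : AddCircle D.length), φ') →
      F (s', φ') = F (s, φ))

/-- The billiard maps `f` of `D` and `g` of `E` are `C⁰`-conjugate near the boundary: there is a
homeomorphism `h` from an open neighbourhood of the boundary circle `φ = 0` of the one closed phase
annulus onto an open neighbourhood of the boundary circle `φ = 0` of the other one that takes
boundary to boundary, and `h ∘ f = g ∘ h` on a collar `0 ≤ φ ≤ δ`. -/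
def ConjugateNearBoundary (D E : StrictlyConvexTable) : Prop :=
  ∃ (h : OpenPartialHomeomorph D.Phase E.Phase) (δ : ℝ), 0 < δ ∧
    (∀ p ∈ h.source, (((h p).2 : ℝ) = 0 ↔ (p.2 : ℝ) = 0)) ∧
    (∀ q : E.Phase, (q.2 : ℝ) = 0 → q ∈ h.target) ∧
    (∀ p : D.Phase, (p.2 : ℝ) ≤ δ →
      p ∈ h.source ∧ D.billiardMap p ∈ h.source ∧
        h (D.billiardMap p) = E.billiardMap (h p))

end StrictlyConvexTable

/-! Parts (i) and (ii) reduce to (iii). A circle is an ellipse with coinciding foci. In an ellipse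
the product of the angular momenta of a trajectory about the two foci is conserved; it equals `b² -
r₁ r₂ sin² φ`, where `r₁`, `r₂` are the distances from the foot point to the foci, so `r₁ r₂ sin² φ`
is an integral of the required kind (`IsEllipse.integrableNearBoundary`).

For (iii), every integrable billiard map is conjugate near `φ = 0` to one and the same twist map
`(θ, ρ) ↦ (θ + ρ, ρ)` on the circle times an interval `[0, r)` (`LevelFamily.exists_normalForm`).
Two billiards are then compared through this model.

The coordinates come from area preservation. The billiard map preserves `sin φ ds dφ`, so each level
curve `F = c` with `c > 0` carries the invariant density `sin φ / (∂F/∂φ)`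
(`NormalizedIntegral.hasDerivAt_level`). Its normalized mass is a coordinate `θ` in which the map is
the translation by a number `ρ c` (`theta_next`). A higher level curve moves every foot point
further, so `ρ` is strictly increasing (`strictMonoOn_rho`).

The difficulty is continuity of `θ` at `c = 0`, where `F` need not be differentiable and the density
may degenerate. There the billiard geometry decides. In the Lazutkin coordinate `x`, the normalized
integral of `curvature ^ (2/3)`, consecutive steps of any short trajectory differ by `o(step²)`
(`lazutkin_second_difference`). One turn takes about `1 / step` steps, so over a whole turn the step
length changes only by a factor `1 + o(1)`. The steps of `θ` are exactly constant and both
coordinates gain one per turn; hence `θ` tends to `x` uniformly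
(`conjugacy_close_of_small_second_difference`, `theta_close_to_lazutkin`). So `θ` extends
continuously by `x`, and `(θ, ρ)` is a homeomorphism up to the boundary. -/

open Set Filter Topology

/-! ### Tools from topology and calculus. -/

/-- The inverses of a continuous family of increasing bijections of the line form a continuous
family. -/
theorem exists_continuous_inverse_family {B : ℝ → ℝ → ℝ} (hB : Continuous fun p : ℝ × ℝ => B p.1 p.2)
    (hm : ∀ s, StrictMono (B s)) (hs : ∀ s, Function.Surjective (B s)) :
    ∃ g : ℝ → ℝ → ℝ, (Continuous fun p : ℝ × ℝ => g p.1 p.2) ∧ ∀ s c, B s (g s c) = c := by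
  choose g hg using hs
  refine ⟨g, continuous_iff_continuousAt.2 fun p => ?_, hg⟩
  -- `a < g s c` is equivalent to `B s a < c`, an open condition on `(s, c)`; upper bounds are
  -- symmetric.
  refine tendsto_order.2 ⟨fun a ha => ?_, fun a ha => ?_⟩
  · have h1 : B p.1 a < p.2 := by
      have := hm p.1 ha
      rwa [hg] at this
    have h2 : IsOpen {q : ℝ × ℝ | B q.1 a < q.2} :=
      isOpen_lt (hB.comp (continuous_fst.prodMk continuous_const)) continuous_snd
    filter_upwards [h2.mem_nhds h1] with q hq
    refine (hm q.1).lt_iff_lt.1 ?_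
    rw [hg]; exact hq
  · have h1 : p.2 < B p.1 a := by
      have := hm p.1 ha
      rwa [hg] at this
    have h2 : IsOpen {q : ℝ × ℝ | q.2 < B q.1 a} :=
      isOpen_lt continuous_snd (hB.comp (continuous_fst.prodMk continuous_const))
    filter_upwards [h2.mem_nhds h1] with q hq
    refine (hm q.1).lt_iff_lt.1 ?_
    rw [hg]; exact hq

/-- A family of increasing functions on `[0, η]`, extended to the line with slope one. -/
noncomputable def extendWithSlopeOne (η : ℝ) (B : ℝ → ℝ → ℝ) (s h : ℝ) : ℝ :=
  B s (max 0 (min h η)) + (h - max 0 (min h η))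

theorem extendWithSlopeOne_of_mem {η : ℝ} (B : ℝ → ℝ → ℝ) (s : ℝ) {h : ℝ} (hh : h ∈ Icc 0 η) :
    extendWithSlopeOne η B s h = B s h := by
  simp [extendWithSlopeOne, min_eq_left hh.2, max_eq_right hh.1]

theorem max_zero_min_mem {η : ℝ} (hη : 0 ≤ η) (h : ℝ) : max 0 (min h η) ∈ Icc 0 η :=
  ⟨le_max_left _ _, max_le hη (min_le_right _ _)⟩

theorem continuous_extendWithSlopeOne {η : ℝ} (hη : 0 ≤ η) {B : ℝ → ℝ → ℝ}
    (hB : ContinuousOn (fun p : ℝ × ℝ => B p.1 p.2) (univ ×ˢ Icc 0 η)) :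
    Continuous fun p : ℝ × ℝ => extendWithSlopeOne η B p.1 p.2 := by
  have h1 : Continuous fun p : ℝ × ℝ => (p.1, max 0 (min p.2 η)) := by fun_prop
  have h2 : Continuous fun p : ℝ × ℝ => B p.1 (max 0 (min p.2 η)) :=
    hB.comp_continuous h1 fun p => ⟨mem_univ _, max_zero_min_mem hη _⟩
  unfold extendWithSlopeOne
  exact h2.add (by fun_prop)

theorem strictMono_extendWithSlopeOne {η : ℝ} (hη : 0 ≤ η) {B : ℝ → ℝ → ℝ} {s : ℝ}
    (hB : StrictMonoOn (B s) (Icc 0 η)) : StrictMono (extendWithSlopeOne η B s) := by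
  intro a b hab
  unfold extendWithSlopeOne
  have h1 : max 0 (min a η) ≤ max 0 (min b η) := by gcongr
  rcases h1.eq_or_lt with h | h
  · rw [h]; linarith
  · have := hB (max_zero_min_mem hη a) (max_zero_min_mem hη b) h
    have h3 : a - max 0 (min a η) ≤ b - max 0 (min b η) := by
      rcases le_total a 0 with ha | ha <;> rcases le_total b 0 with hb | hb <;>
      rcases le_total a η with ha' | ha' <;> rcases le_total b η with hb' | hb' <;>
      simp [*] <;> linarith
    linarith

/-- `exists_continuous_inverse_family` wants bijections of the whole line; the extension supplies
them from functions that are controlled on a short interval only. -/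
theorem surjective_extendWithSlopeOne {η : ℝ} (hη : 0 ≤ η) {B : ℝ → ℝ → ℝ} (s : ℝ)
    (hB : ContinuousOn (fun p : ℝ × ℝ => B p.1 p.2) (univ ×ˢ Icc 0 η)) :
    Function.Surjective (extendWithSlopeOne η B s) := by
  have hc : Continuous (extendWithSlopeOne η B s) :=
    (continuous_extendWithSlopeOne hη hB).comp (continuous_const.prodMk continuous_id)
  refine hc.surjective ?_ ?_
  · refine tendsto_atTop_mono' atTop (f₁ := fun h => B s η + (h - η)) ?_ ?_
    · filter_upwards [eventually_ge_atTop η] with h hh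
      simp [extendWithSlopeOne, min_eq_right hh, max_eq_right hη]
    · exact tendsto_atTop_add_const_left _ _ (tendsto_atTop_add_const_right _ _ tendsto_id)
  · refine tendsto_atBot_mono' atBot (f₁ := fun h => B s 0 + h) ?_ ?_
    · filter_upwards [eventually_le_atBot 0] with h hh
      simp [extendWithSlopeOne, min_eq_left (hh.trans hη), max_eq_left hh]
    · exact tendsto_atBot_add_const_left _ _ tendsto_id

/-- Derivative of an implicitly defined function of one variable that is known to be continuous. -/
theorem HasFDerivAt.hasDerivAt_implicit {A : ℝ × ℝ → ℝ} {A' : ℝ × ℝ →L[ℝ] ℝ} {f : ℝ → ℝ} {s c : ℝ}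
    (hA : HasFDerivAt A A' (s, f s)) (h2 : A' (0, 1) ≠ 0) (hf : ContinuousAt f s)
    (hc : ∀ᶠ t in 𝓝 s, A (t, f t) = c) : HasDerivAt f (-(A' (1, 0)) / A' (0, 1)) s := by
  set a := A' (1, 0) with ha
  set b := A' (0, 1) with hb
  have hA' : ∀ u v : ℝ, A' (u, v) = a * u + b * v := by
    intro u v
    have : ((u, v) : ℝ × ℝ) = u • ((1, 0) : ℝ × ℝ) + v • ((0, 1) : ℝ × ℝ) := by simp
    rw [this, map_add, map_smul, map_smul]
    simp [← ha, ← hb, mul_comm]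
  have hb0 : 0 < |b| := abs_pos.2 h2
  have hcs := hc.self_of_nhds
  -- `A` is constant along the graph of `f`, so its linear part is as small as the remainder.
  -- Differentiability at the single point `(s, f s)` is enough for this.
  have key : ∀ ε > 0, ∀ᶠ t in 𝓝 s, |a * (t - s) + b * (f t - f s)| ≤ ε * (|t - s| + |f t - f s|) := by
    intro ε hε
    have h3 : Tendsto (fun t => (t, f t)) (𝓝 s) (𝓝 (s, f s)) := tendsto_id.prodMk_nhds hf
    filter_upwards [hc, h3.eventually (hA.isLittleO.def hε)] with t ht1 ht2
    simp only [ht1, hcs, Prod.mk_sub_mk, hA', sub_self, zero_sub, norm_neg, Real.norm_eq_abs] at ht2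
    refine ht2.trans (mul_le_mul_of_nonneg_left ?_ hε.le)
    rw [Prod.norm_def]
    exact max_le (by simp) (by simp)
  -- The bound `key` with `ε = |b| / 2` lets half of `|b| |f t - f s|` be absorbed on the left,
  -- which leaves this Lipschitz constant.
  set K := (|a| + |b| / 2) / (|b| / 2) with hK
  have hK0 : 0 ≤ K := by positivity
  have hlip : ∀ᶠ t in 𝓝 s, |f t - f s| ≤ K * |t - s| := by
    filter_upwards [key (|b| / 2) (by positivity)] with t ht
    have h4 : |b| * |f t - f s| ≤ |a * (t - s) + b * (f t - f s)| + |a| * |t - s| := by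
      rw [← abs_mul, ← abs_mul]
      have := abs_sub (a * (t - s) + b * (f t - f s)) (a * (t - s))
      simpa using this
    rw [hK, div_mul_eq_mul_div, le_div_iff₀ (by positivity)]
    nlinarith
  rw [hasDerivAt_iff_isLittleO]
  refine Asymptotics.IsLittleO.of_bound fun ε hε => ?_
  have hε' : 0 < ε * |b| / (1 + K) := by positivity
  filter_upwards [hlip, key _ hε'] with t h5 h6
  have h7 : f t - f s - (t - s) • (-a / b) = (a * (t - s) + b * (f t - f s)) / b := by
    simp only [smul_eq_mul]; field_simp; ring
  rw [h7, Real.norm_eq_abs, Real.norm_eq_abs, abs_div, div_le_iff₀ hb0]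
  refine h6.trans ?_
  have h8 : |t - s| + |f t - f s| ≤ (1 + K) * |t - s| := by linarith
  calc ε * |b| / (1 + K) * (|t - s| + |f t - f s|) ≤ ε * |b| / (1 + K) * ((1 + K) * |t - s|) := by
        gcongr
    _ = ε * |t - s| * |b| := by field_simp

/-- A remainder whose derivative is `o(t ^ n)`, uniformly in a parameter, is `o(t ^ (n + 1))`,
uniformly. -/
theorem uniform_remainder_step {E : Type*} [NormedAddCommGroup E] [NormedSpace ℝ E] {n : ℕ}
    {r r' : ℝ → ℝ → E} (hd : ∀ s t, HasDerivAt (r s) (r' s t) t) (h0 : ∀ s, r s 0 = 0)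
    (h : ∀ ε > 0, ∃ η > 0, ∀ s t : ℝ, |t| < η → ‖r' s t‖ ≤ ε * |t| ^ n) :
    ∀ ε > 0, ∃ η > 0, ∀ s t : ℝ, |t| < η → ‖r s t‖ ≤ ε * |t| ^ (n + 1) := by
  intro ε hε
  obtain ⟨η, hη, hr⟩ := h ε hε
  refine ⟨η, hη, fun s t ht => ?_⟩
  have hsub : ∀ v ∈ uIcc 0 t, |v| ≤ |t| := by
    intro v hv
    have := abs_sub_left_of_mem_uIcc hv
    simpa using this
  have := Convex.norm_image_sub_le_of_norm_hasDerivWithin_le (s := uIcc 0 t) (f := r s)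
    (f' := r' s) (C := ε * |t| ^ n) (x := 0) (y := t)
    (fun v _ => (hd s v).hasDerivWithinAt)
    (fun v hv => (hr s v ((hsub v hv).trans_lt ht)).trans
      (mul_le_mul_of_nonneg_left (pow_le_pow_left₀ (abs_nonneg v) (hsub v hv) n) hε.le))
    (convex_uIcc 0 t) left_mem_uIcc right_mem_uIcc
  rw [h0, sub_zero, sub_zero, Real.norm_eq_abs] at this
  rw [pow_succ, ← mul_assoc]; exact this

theorem exists_pos_le_of_periodic {f : ℝ → ℝ} {l : ℝ} (hl : 0 < l) (hf : Continuous f)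
    (hp : Function.Periodic f l) (h : ∀ s, 0 < f s) : ∃ c > 0, ∀ s, c ≤ f s := by
  obtain ⟨a, -, ha⟩ := (isCompact_Icc (a := (0 : ℝ)) (b := l)).exists_isMinOn
    ⟨0, by simp [hl.le]⟩ hf.continuousOn
  refine ⟨f a, h a, fun s => ?_⟩
  obtain ⟨t, ht, hst⟩ := hp.exists_mem_Ico₀ hl s
  rw [hst]
  exact ha ⟨ht.1, ht.2.le⟩

theorem exists_abs_le_of_periodic {f : ℝ → ℝ} {l : ℝ} (hl : 0 < l) (hf : Continuous f)
    (hp : Function.Periodic f l) : ∃ C, ∀ s, |f s| ≤ C := by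
  obtain ⟨C, hC⟩ := (isCompact_Icc (a := (0 : ℝ)) (b := l)).exists_bound_of_continuousOn
    hf.continuousOn
  refine ⟨C, fun s => ?_⟩
  obtain ⟨t, ht, hst⟩ := hp.exists_mem_Ico₀ hl s
  rw [hst]
  exact hC t ⟨ht.1, ht.2.le⟩

theorem uniformContinuous_of_periodic {E : Type*} [NormedAddCommGroup E] {f : ℝ → E} {l : ℝ}
    (hl : 0 < l) (hf : Continuous f) (hp : Function.Periodic f l) : UniformContinuous f := by
  have := Fact.mk hl
  have hc : Continuous (hp.lift : AddCircle l → E) := by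
    exact continuous_quot_lift _ hf
  have h2 := CompactSpace.uniformContinuous_of_continuous hc
  have h3 : UniformContinuous (fun x : ℝ => (x : AddCircle l)) := by
    exact uniformContinuous_of_continuousAt_zero (QuotientAddGroup.mk' (AddSubgroup.zmultiples l))
      (continuous_quotient_mk'.continuousAt)
  exact h2.comp h3

/-- A function that vanishes for `h = 0` and is periodic in `s` is small, uniformly in `s`, for
small `h ≥ 0`. -/
theorem exists_uniform_small {G : ℝ → ℝ → ℝ} {l η : ℝ} (hl : 0 < l) (hη : 0 < η)
    (hG : ContinuousOn (fun p : ℝ × ℝ => G p.1 p.2) (univ ×ˢ Icc 0 η))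
    (hp : ∀ s h, G (s + l) h = G s h) (h0 : ∀ s, G s 0 = 0) {ε : ℝ} (hε : 0 < ε) :
    ∃ r > 0, r ≤ η ∧ ∀ s, ∀ h ∈ Icc 0 r, |G s h| < ε := by
  have hK : IsCompact (Icc (0 : ℝ) l ×ˢ Icc (0 : ℝ) η) := isCompact_Icc.prod isCompact_Icc
  have hu := hK.uniformContinuousOn_of_continuous
    (hG.mono (prod_mono (subset_univ _) subset_rfl))
  obtain ⟨r, hr, h⟩ := Metric.uniformContinuousOn_iff.1 hu ε hε
  refine ⟨min (r / 2) η, by positivity, min_le_right _ _, fun s x hx => ?_⟩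
  obtain ⟨t, ht, hst⟩ := Function.Periodic.exists_mem_Ico₀ (f := fun s => G s x) (c := l)
    (fun s => hp s x) hl s
  rw [hst]
  have hxη : x ≤ η := hx.2.trans (min_le_right _ _)
  have := h (t, x) ⟨⟨ht.1, ht.2.le⟩, hx.1, hxη⟩ (t, 0) ⟨⟨ht.1, ht.2.le⟩, le_rfl, hη.le⟩ (by
    rw [Prod.dist_eq, dist_self, Real.dist_eq, sub_zero, abs_of_nonneg hx.1]
    have := hx.2.trans (min_le_left _ _)
    exact max_lt hr (by linarith))
  simpa [h0, Real.dist_eq] using this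

/-- A continuous map factors continuously through a continuous map on a compact set if it is
constant on its fibres. -/
theorem exists_continuousOn_factor {Z X Y : Type*} [TopologicalSpace Z]
    [T2Space Z] [TopologicalSpace X] [T2Space X] [TopologicalSpace Y]
    {K : Set Z} (hK : IsCompact K) (hne : K.Nonempty) {P : Z → X} {Q : Z → Y}
    (hP : ContinuousOn P K) (hQ : ContinuousOn Q K)
    (hfib : ∀ a ∈ K, ∀ b ∈ K, P a = P b → Q a = Q b) :
    ∃ f : X → Y, ContinuousOn f (P '' K) ∧ ∀ a ∈ K, f (P a) = Q a := by
  have hex : ∀ x : X, ∃ y : Y, ∀ a ∈ K, P a = x → Q a = y := by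
    intro x
    by_cases hx : ∃ a ∈ K, P a = x
    · obtain ⟨a, ha, rfl⟩ := hx
      exact ⟨Q a, fun b hb hab => hfib b hb a ha hab⟩
    · obtain ⟨a, -⟩ := hne
      exact ⟨Q a, fun b hb hab => (hx ⟨b, hb, hab⟩).elim⟩
  choose f hf using hex
  have hfP : ∀ a ∈ K, f (P a) = Q a := fun a ha => (hf _ a ha rfl).symm
  refine ⟨f, ?_, hfP⟩
  rw [continuousOn_iff_isClosed]
  intro t ht
  -- The part of `K` over a closed set is compact, so its image is closed: `P` is a quotient map
  -- onto `P '' K`.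
  refine ⟨P '' (K ∩ Q ⁻¹' t), ?_, ?_⟩
  · have h1 : IsClosed (K ∩ Q ⁻¹' t) := hQ.preimage_isClosed_of_isClosed hK.isClosed ht
    exact ((hK.of_isClosed_subset h1 inter_subset_left).image_of_continuousOn
      (hP.mono inter_subset_left)).isClosed
  · ext x
    constructor
    · rintro ⟨hx, a, ha, rfl⟩
      refine ⟨⟨a, ⟨ha, ?_⟩, rfl⟩, ⟨a, ha, rfl⟩⟩
      simpa [hfP a ha] using hx
    · rintro ⟨⟨a, ⟨ha, hat⟩, rfl⟩, -⟩
      exact ⟨by simpa [hfP a ha] using hat, a, ha, rfl⟩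

/-- Two continuous maps with the same fibres on a compact set identify corresponding open sets. -/
theorem exists_openPartialHomeomorph_of_fibres {Z X Y : Type*} [TopologicalSpace Z]
    [T2Space Z] [TopologicalSpace X] [T2Space X] [TopologicalSpace Y] [T2Space Y]
    {K : Set Z} (hK : IsCompact K) (hne : K.Nonempty) {P : Z → X} {Q : Z → Y}
    (hP : ContinuousOn P K)
    (hQ : ContinuousOn Q K) (hfib : ∀ a ∈ K, ∀ b ∈ K, P a = P b ↔ Q a = Q b)
    {U : Set X} {V : Set Y} (hU : IsOpen U) (hV : IsOpen V) (hUK : U ⊆ P '' K) (hVK : V ⊆ Q '' K)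
    (hUV : ∀ a ∈ K, P a ∈ U ↔ Q a ∈ V) :
    ∃ H : OpenPartialHomeomorph X Y, H.source = U ∧ H.target = V ∧
      ∀ a ∈ K, P a ∈ U → H (P a) = Q a := by
  obtain ⟨f, hfc, hf⟩ := exists_continuousOn_factor hK hne hP hQ fun a ha b hb => (hfib a ha b hb).1
  obtain ⟨g, hgc, hg⟩ := exists_continuousOn_factor hK hne hQ hP fun a ha b hb => (hfib a ha b hb).2
  refine ⟨{ toFun := f, invFun := g, source := U, target := V, map_source' := ?_,
            map_target' := ?_, left_inv' := ?_, right_inv' := ?_, open_source := hU,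
            open_target := hV, continuousOn_toFun := hfc.mono hUK,
            continuousOn_invFun := hgc.mono hVK }, rfl, rfl, fun a ha _ => hf a ha⟩
  · intro x hx
    obtain ⟨a, ha, rfl⟩ := hUK hx
    rw [hf a ha]; exact (hUV a ha).1 hx
  · intro x hx
    obtain ⟨a, ha, rfl⟩ := hVK hx
    rw [hg a ha]; exact (hUV a ha).2 hx
  · intro x hx
    obtain ⟨a, ha, rfl⟩ := hUK hx
    rw [hf a ha, hg a ha]
  · intro x hx
    obtain ⟨a, ha, rfl⟩ := hVK hx
    rw [hg a ha, hf a ha]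

/-! ### Dynamics of circle maps: almost constant steps and translation numbers. -/

/-- A sequence of small positive steps whose second differences are of higher order than the
squares of the steps has almost constant steps, as long as it stays below one. -/
theorem abs_step_sub_le {u : ℕ → ℝ} {ε : ℝ} (hε : 0 < ε) (hε' : ε ≤ 1 / 100) (hu0 : u 0 = 0)
    (hpos : ∀ n, 0 < u (n + 1) - u n) (hle : ∀ n, u (n + 1) - u n ≤ ε)
    (hsec : ∀ n, |(u (n + 2) - u (n + 1)) - (u (n + 1) - u n)|
      ≤ ε * ((u (n + 1) - u n) ^ 2 + (u (n + 2) - u (n + 1)) ^ 2)) (n : ℕ) (hn : u n ≤ 1) :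
    |(u (n + 1) - u n) - u 1| ≤ 20 * ε * u 1 := by
  -- One step `y` changes the step length by a factor between `(1 + 10 ε y)⁻¹` and `1 + 10 ε y`. The
  -- steps add up to `u`, so these factors multiply to at most `exp (10 ε u)`, which is bounded
  -- while `u ≤ 1` however many steps there are.
  have hind : ∀ n, u (n + 1) - u n ≤ u 1 * Real.exp (10 * ε * u n) ∧
      u 1 ≤ (u (n + 1) - u n) * Real.exp (10 * ε * u n) := by
    intro n
    induction n with
    | zero => simp [hu0]
    | succ n ih =>
      have hy := hpos n
      have hy' := hpos (n + 1)
      have hl := hle n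
      have hl' := hle (n + 1)
      have h := abs_le.1 (hsec n)
      rw [show n + 1 + 1 = n + 2 from rfl] at *
      set y := u (n + 1) - u n with hy_def
      set z := u (n + 2) - u (n + 1) with hz_def
      have h2 : z ≤ 2 * y := by nlinarith [h.1, h.2]
      have h3 : y ≤ 2 * z := by nlinarith [h.1, h.2]
      have h4 : z ≤ y * (1 + 10 * ε * y) := by
        have : z ^ 2 ≤ (2 * y) ^ 2 := by gcongr
        nlinarith [h.1, h.2, mul_pos hε (pow_pos hy 2)]
      have h5 : y ≤ z * (1 + 10 * ε * y) := by
        have : y * y ≤ (2 * z) * y := by gcongr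
        have h6 : z * z ≤ z * (2 * y) := by gcongr
        nlinarith [h.1, h.2, mul_pos hε (mul_pos hy hy')]
      have h7 : 1 + 10 * ε * y ≤ Real.exp (10 * ε * y) := by
        linarith [Real.add_one_le_exp (10 * ε * y)]
      have h8 : Real.exp (10 * ε * u (n + 1)) = Real.exp (10 * ε * u n) * Real.exp (10 * ε * y) := by
        rw [← Real.exp_add]; congr 1; rw [hy_def]; ring
      have hu1 : 0 < u 1 := by simpa [hu0] using hpos 0
      rw [h8]
      constructor
      · calc z ≤ y * Real.exp (10 * ε * y) := h4.trans (by gcongr)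
          _ ≤ (u 1 * Real.exp (10 * ε * u n)) * Real.exp (10 * ε * y) := by
            gcongr; exact ih.1
          _ = _ := by ring
      · calc u 1 ≤ y * Real.exp (10 * ε * u n) := ih.2
          _ ≤ (z * Real.exp (10 * ε * y)) * Real.exp (10 * ε * u n) := by
            gcongr; exact h5.trans (by gcongr)
          _ = _ := by ring
  have hu1 : 0 < u 1 := by simpa [hu0] using hpos 0
  -- By `exp x ≤ 1 / (1 - x)` with `x = 10 ε ≤ 1 / 10`.
  have he : Real.exp (10 * ε * u n) ≤ 1 + 20 * ε := by
    have h1 : Real.exp (10 * ε * u n) ≤ Real.exp (10 * ε) := by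
      apply Real.exp_le_exp.2; nlinarith
    have h2 := Real.exp_bound_div_one_sub_of_interval (x := 10 * ε) (by positivity) (by linarith)
    refine (h1.trans h2).trans ?_
    rw [div_le_iff₀ (by linarith)]
    nlinarith
  obtain ⟨h1, h2⟩ := hind n
  have hy := hpos n
  rw [abs_le]
  constructor
  · have : u 1 ≤ (u (n + 1) - u n) * (1 + 20 * ε) := h2.trans (by gcongr)
    by_contra! hlt
    have h3 : (u (n + 1) - u n) * (1 + 20 * ε) < (u 1 - 20 * ε * u 1) * (1 + 20 * ε) :=
      mul_lt_mul_of_pos_right (by linarith) (by linarith)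
    nlinarith [mul_pos hu1 (pow_pos hε 2)]
  · have : u (n + 1) - u n ≤ u 1 * (1 + 20 * ε) := h1.trans (by gcongr)
    nlinarith

/-- If a lift of a circle homeomorphism is conjugate to a translation by `θ` and has almost
constant steps in the coordinate `x`, then `θ` is close to `x`. -/
theorem conjugacy_close_of_small_second_difference {f θ x : ℝ → ℝ} {ρ l ε : ℝ} (hl : 0 < l)
    (hε : 0 < ε) (hε' : ε ≤ 1 / 100) (hθ0 : θ 0 = 0) (hx0 : x 0 = 0) (hθl : θ l = 1) (hxl : x l = 1)
    (hθ : StrictMono θ) (hx : StrictMono x) (hconj : ∀ s, θ (f s) = θ s + ρ)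
    (hpos : ∀ s, 0 < x (f s) - x s) (hle : ∀ s, x (f s) - x s ≤ ε)
    (hsec : ∀ s, |(x (f (f s)) - x (f s)) - (x (f s) - x s)|
      ≤ ε * ((x (f s) - x s) ^ 2 + (x (f (f s)) - x (f s)) ^ 2)) :
    ρ ≤ 2 * ε ∧ ∀ s ∈ Icc 0 l, |θ s - x s| ≤ 60 * ε := by
  have hρ : 0 < ρ := by
    have h1 : (0 : ℝ) < f 0 := hx.lt_iff_lt.1 (by have := hpos 0; linarith)
    have h2 := hθ h1
    rw [hconj, hθ0] at h2; linarith
  -- Both coordinates are read along the orbit of `0`: there `θ` is exactly `n * ρ`, and `x` is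
  -- nearly `n * x (p 1)`.
  set p : ℕ → ℝ := fun n => f^[n] 0 with hp
  have hps : ∀ n, p (n + 1) = f (p n) := fun n => Function.iterate_succ_apply' f n 0
  have hp0 : p 0 = 0 := rfl
  have hθp : ∀ n, θ (p n) = n * ρ := by
    intro n
    induction n with
    | zero => simp [hp0, hθ0]
    | succ n ih => rw [hps, hconj, ih]; push_cast; ring
  set u : ℕ → ℝ := fun n => x (p n) with hu
  have hu0 : u 0 = 0 := by simp [hu, hp0, hx0]
  have hupos : ∀ n, 0 < u (n + 1) - u n := fun n => by simp only [hu, hps]; exact hpos _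
  have hule : ∀ n, u (n + 1) - u n ≤ ε := fun n => by simp only [hu, hps]; exact hle _
  have husec : ∀ n, |(u (n + 2) - u (n + 1)) - (u (n + 1) - u n)|
      ≤ ε * ((u (n + 1) - u n) ^ 2 + (u (n + 2) - u (n + 1)) ^ 2) := fun n => by
    simp only [hu, hps]; exact hsec _
  have hstep := abs_step_sub_le hε hε' hu0 hupos hule husec
  have hmono : StrictMono u := strictMono_nat_of_lt_succ fun n => by have := hupos n; linarith
  have hu1 : 0 < u 1 := by simpa [hu0] using hupos 0
  have hsum : ∀ n : ℕ, u n ≤ 1 → |u n - n * u 1| ≤ 20 * ε * (n * u 1) := by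
    intro n
    induction n with
    | zero => simp [hu0]
    | succ n ih =>
      intro hn
      have hn' : u n ≤ 1 := (hmono n.lt_succ_self).le.trans hn
      have h1 := abs_le.1 (ih hn')
      have h2 := abs_le.1 (hstep n hn')
      rw [abs_le]; push_cast
      constructor <;> nlinarith [h1.1, h1.2, h2.1, h2.2]
  have hloc : ∀ s, 0 ≤ s → ∃ n : ℕ, p n ≤ s ∧ s < p (n + 1) := by
    intro s hs
    have hs' : 0 ≤ θ s := by rw [← hθ0]; exact hθ.monotone hs
    refine ⟨⌊θ s / ρ⌋₊, hθ.le_iff_le.1 ?_, hθ.lt_iff_lt.1 ?_⟩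
    · rw [hθp, ← le_div_iff₀ hρ]; exact Nat.floor_le (by positivity)
    · rw [hθp, ← div_lt_iff₀ hρ]; push_cast; exact Nat.lt_floor_add_one _
  -- `N` is the number of steps in one turn. Both `N * ρ` and `N * u 1` are within a multiple of `ε`
  -- of `1`, which ties the two step lengths together.
  obtain ⟨N, hN1, hN2⟩ := hloc l hl.le
  have huN : u N ≤ 1 := by rw [← hxl]; exact hx.monotone hN1
  have huN' : 1 < u N + ε := by
    have : x l < u (N + 1) := hx hN2
    have := hule N
    linarith
  have hθN : N * ρ ≤ 1 := by rw [← hθp, ← hθl]; exact hθ.monotone hN1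
  have hθN' : 1 < N * ρ + ρ := by
    have h := hθ hN2
    rw [hθp, hθl] at h
    push_cast at h; linarith
  have hNu := abs_le.1 (hsum N huN)
  have hNu1 : N * u 1 ≤ 5 / 4 := by nlinarith [hNu.1]
  have hNpos : (0 : ℝ) ≤ N := N.cast_nonneg
  have hNε : 1 ≤ N * (2 * ε) := by
    have : u 1 ≤ ε := by simpa [hu0] using hule 0
    have h3 : (N : ℝ) * u 1 ≤ N * ε := by gcongr
    nlinarith [hNu.2]
  have hN0 : (0 : ℝ) < N := by
    by_contra h
    have : (N : ℝ) = 0 := le_antisymm (not_lt.1 h) hNpos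
    rw [this] at hNε; linarith
  have hρε : ρ ≤ 2 * ε := by
    have : (N : ℝ) * ρ ≤ N * (2 * ε) := hθN.trans hNε
    exact le_of_mul_le_mul_left this hN0
  refine ⟨hρε, fun s hs => ?_⟩
  obtain ⟨n, hn1, hn2⟩ := hloc s hs.1
  have hun : u n ≤ 1 := by rw [← hxl]; exact hx.monotone (hn1.trans hs.2)
  have hnN : n ≤ N := by
    by_contra h
    push Not at h
    have h1 : u (N + 1) ≤ u n := hmono.monotone h
    have h2 : x l < u (N + 1) := hx hN2
    linarith
  have hnN' : (n : ℝ) ≤ N := by exact_mod_cast hnN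
  have h1 : x s - u n ≤ ε := by
    have : x s ≤ u (n + 1) := (hx hn2).le
    linarith [hule n]
  have h1' : 0 ≤ x s - u n := by linarith [hx.monotone hn1]
  have h2 : θ s - n * ρ ≤ 2 * ε := by
    have h := hθ hn2
    rw [hθp] at h; push_cast at h; linarith
  have h2' : 0 ≤ θ s - n * ρ := by
    have h := hθ.monotone hn1
    rw [hθp] at h; linarith
  have h3 : |u n - n * u 1| ≤ 25 * ε := by
    refine (hsum n hun).trans ?_
    have : n * u 1 ≤ 5 / 4 := by
      refine le_trans ?_ hNu1
      gcongr
    nlinarith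
  have h4 : |N * u 1 - N * ρ| ≤ 28 * ε := by
    rw [abs_le]; constructor <;> nlinarith [hNu.1, hNu.2]
  -- The discrepancy grows linearly in the number of steps, so it is largest at `N`.
  have h5 : |n * u 1 - n * ρ| ≤ 28 * ε := by
    refine le_trans ?_ h4
    rw [← mul_sub, ← mul_sub, abs_mul, abs_mul, abs_of_nonneg hNpos,
      abs_of_nonneg (n.cast_nonneg : (0 : ℝ) ≤ n)]
    gcongr
  have h3' := abs_le.1 h3
  have h5' := abs_le.1 h5
  -- The errors add up to `(2 + 28 + 25 + 1) ε`.
  rw [abs_le]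
  constructor <;> linarith [h3'.1, h3'.2, h5'.1, h5'.2]

/-- If two lifts of circle maps that are conjugate to translations satisfy `f < g` pointwise, then
their translation numbers are strictly ordered. -/
theorem translation_lt_of_lt {f g θ τ : ℝ → ℝ} {ρ σ l : ℝ} (hl : 0 < l) (hf : Continuous f)
    (hg : Continuous g) (hθc : Continuous θ) (hτc : Continuous τ)
    (hfp : ∀ s, f (s + l) = f s + l) (hgp : ∀ s, g (s + l) = g s + l)
    (hθp : ∀ s, θ (s + l) = θ s + 1) (hτp : ∀ s, τ (s + l) = τ s + 1)
    (hθ : StrictMono θ) (hfθ : ∀ s, θ (f s) = θ s + ρ) (hgτ : ∀ s, τ (g s) = τ s + σ)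
    (hfg : ∀ s, f s < g s) : ρ < σ := by
  -- Compactness makes the gap between `f` and `g`, measured in `θ`, at least some `c > 0`. So `g`
  -- advances `θ` by at least `ρ + c` per step and `τ` by exactly `σ`, while `θ - τ` stays bounded;
  -- `σ ≤ ρ` is then impossible.
  obtain ⟨c, hc, hcs⟩ := exists_pos_le_of_periodic (f := fun s => θ (g s) - θ (f s)) hl
    ((hθc.comp hg).sub (hθc.comp hf)) (fun s => by simp only [hfp, hgp, hθp]; ring)
    (fun s => sub_pos.2 (hθ (hfg s)))
  obtain ⟨C, hC⟩ := exists_abs_le_of_periodic (f := fun s => θ s - τ s) hl (hθc.sub hτc)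
    (fun s => by simp only [hθp, hτp]; ring)
  have h1 : ∀ n : ℕ, θ 0 + n * (ρ + c) ≤ θ (g^[n] 0) := by
    intro n
    induction n with
    | zero => simp
    | succ n ih =>
      rw [Function.iterate_succ_apply']
      have h2 := hcs (g^[n] 0)
      rw [hfθ] at h2
      push_cast; linarith
  have h2 : ∀ n : ℕ, τ (g^[n] 0) = τ 0 + n * σ := by
    intro n
    induction n with
    | zero => simp
    | succ n ih => rw [Function.iterate_succ_apply', hgτ, ih]; push_cast; ring
  by_contra h
  push Not at h
  obtain ⟨n, hn⟩ := exists_nat_gt (2 * C / c)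
  rw [div_lt_iff₀ hc] at hn
  have h3 := abs_le.1 (hC 0)
  have h4 := abs_le.1 (hC (g^[n] 0))
  have h5 := h1 n
  have h6 := h2 n
  have h7 : (n : ℝ) * σ ≤ n * ρ := by gcongr
  nlinarith [h3.1, h3.2, h4.1, h4.2]

/-! ### Chords, their angles, and the lift of the billiard map. -/

namespace StrictlyConvexTable

variable (D : StrictlyConvexTable)

theorem continuous_deriv : Continuous (deriv D.γ) := D.contDiff.continuous_deriv (by norm_num)

theorem hasDerivAt (s : ℝ) : HasDerivAt D.γ (deriv D.γ s) s :=
  (D.contDiff.differentiable (by norm_num) s).hasDerivAt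

theorem contDiff_deriv : ContDiff ℝ 2 (deriv D.γ) := D.contDiff.deriv' (n := 2)

theorem point_coe (s : ℝ) : D.point (s : AddCircle D.length) = D.γ s := D.periodic.lift_coe s

theorem tangent_coe (s : ℝ) : D.tangent (s : AddCircle D.length) = deriv D.γ s :=
  D.periodic_deriv.lift_coe s

theorem deriv_mul_conj (s : ℝ) : deriv D.γ s * (starRingEnd ℂ) (deriv D.γ s) = 1 := by
  rw [Complex.mul_conj, Complex.normSq_eq_norm_sq, D.unit_speed]; norm_num

theorem deriv_ne_zero (s : ℝ) : deriv D.γ s ≠ 0 := by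
  have := D.unit_speed s
  intro h
  simp [h] at this

/-- The chord from `γ s` to `γ t`, divided by `t - s`. -/
noncomputable def chordSlope (s t : ℝ) : ℂ := ∫ u in (0 : ℝ)..1, deriv D.γ (s + u * (t - s))

/-- The integral form has the value `γ' s` on the diagonal, so that both chord angles are continuous
down to chords of length zero. -/
theorem continuous_chordSlope : Continuous fun p : ℝ × ℝ => D.chordSlope p.1 p.2 := by
  unfold chordSlope
  refine intervalIntegral.continuous_parametric_intervalIntegral_of_continuous'
    (f := fun (p : ℝ × ℝ) (u : ℝ) => deriv D.γ (p.1 + u * (p.2 - p.1))) ?_ 0 1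
  exact D.continuous_deriv.comp (by fun_prop)

theorem sub_mul_chordSlope (s t : ℝ) : ((t - s : ℝ) : ℂ) * D.chordSlope s t = D.γ t - D.γ s := by
  have h1 : ∀ u ∈ uIcc (0 : ℝ) 1, HasDerivAt (fun u : ℝ => D.γ (s + u * (t - s)))
      (((t - s : ℝ) : ℂ) * deriv D.γ (s + u * (t - s))) u := by
    intro u _
    have h2 : HasDerivAt (fun u : ℝ => s + u * (t - s)) (t - s) u := by
      simpa using ((hasDerivAt_id u).mul_const (t - s)).const_add s
    have := (D.hasDerivAt (s + u * (t - s))).scomp u h2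
    simpa [Function.comp_def] using this
  have h3 := intervalIntegral.integral_eq_sub_of_hasDerivAt h1 (by
    apply Continuous.intervalIntegrable
    exact continuous_const.mul (D.continuous_deriv.comp (by fun_prop)))
  rw [intervalIntegral.integral_const_mul] at h3
  rw [chordSlope, h3]
  simp

theorem chordSlope_self (s : ℝ) : D.chordSlope s s = deriv D.γ s := by simp [chordSlope]

theorem chordSlope_add_length (s t : ℝ) :
    D.chordSlope (s + D.length) (t + D.length) = D.chordSlope s t := by
  unfold chordSlope
  congr 1
  ext u
  rw [← D.periodic_deriv (s + u * (t - s))]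
  congr 1; ring

/-- The angle that the chord from `γ s` to `γ t` makes with the tangent at `γ s`. -/
noncomputable def angleOut (s t : ℝ) : ℝ :=
  (D.chordSlope s t * (starRingEnd ℂ) (deriv D.γ s)).arg

/-- The angle that the chord from `γ s` to `γ t` makes with the tangent at `γ t`. -/
noncomputable def angleIn (s t : ℝ) : ℝ :=
  ((starRingEnd ℂ) (D.chordSlope s t) * deriv D.γ t).arg

theorem angleOut_self (s : ℝ) : D.angleOut s s = 0 := by
  rw [angleOut, chordSlope_self, deriv_mul_conj, Complex.arg_one]

theorem angleIn_self (s : ℝ) : D.angleIn s s = 0 := by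
  rw [angleIn, chordSlope_self, mul_comm, deriv_mul_conj, Complex.arg_one]

theorem angleOut_add_length (s t : ℝ) :
    D.angleOut (s + D.length) (t + D.length) = D.angleOut s t := by
  rw [angleOut, angleOut, chordSlope_add_length, D.periodic_deriv]

theorem angleIn_add_length (s t : ℝ) :
    D.angleIn (s + D.length) (t + D.length) = D.angleIn s t := by
  rw [angleIn, angleIn, chordSlope_add_length, D.periodic_deriv]

variable {D} {s t : ℝ}

theorem not_add_int_mul_of_mem_Ioo (h : t ∈ Ioo s (s + D.length)) (n : ℤ) :
    t ≠ s + n * D.length := by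
  intro hn
  rw [hn] at h
  have hl := D.length_pos
  have h1 : (0 : ℝ) < n := by
    by_contra hc
    push Not at hc
    nlinarith [h.1]
  have h2 : (n : ℝ) < 1 := by
    by_contra hc
    push Not at hc
    nlinarith [h.2]
  have h3 : (0 : ℤ) < n := by exact_mod_cast h1
  have h4 : n < (1 : ℤ) := by exact_mod_cast h2
  omega

theorem chord_mul_conj_im_pos (h : t ∈ Ioo s (s + D.length)) :
    0 < ((D.γ t - D.γ s) * (starRingEnd ℂ) (deriv D.γ s)).im := by
  have := D.strictly_left s t (not_add_int_mul_of_mem_Ioo h)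
  rwa [mul_comm] at this

theorem conj_chord_mul_im_pos (h : t ∈ Ioo s (s + D.length)) :
    0 < ((starRingEnd ℂ) (D.γ t - D.γ s) * deriv D.γ t).im := by
  -- Seen from `t`, the point `γ s` lies ahead, at parameter `s + D.length`.
  have h1 : s + D.length ∈ Ioo t (t + D.length) := ⟨h.2, by linarith [h.1]⟩
  have := D.strictly_left t _ (not_add_int_mul_of_mem_Ioo h1)
  rw [D.periodic] at this
  simp only [map_sub, Complex.mul_im, Complex.sub_re, Complex.sub_im, Complex.conj_re,
    Complex.conj_im] at this ⊢
  linarith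

theorem chord_ne_zero (h : t ∈ Ioo s (s + D.length)) : D.γ t - D.γ s ≠ 0 := by
  intro h0
  have := chord_mul_conj_im_pos h
  simp [h0] at this

theorem angleOut_eq_arg (h : s < t) :
    D.angleOut s t = ((D.γ t - D.γ s) * (starRingEnd ℂ) (deriv D.γ s)).arg := by
  rw [← sub_mul_chordSlope, mul_assoc, Complex.arg_real_mul _ (sub_pos.2 h), angleOut]

theorem angleIn_eq_arg (h : s < t) :
    D.angleIn s t = ((starRingEnd ℂ) (D.γ t - D.γ s) * deriv D.γ t).arg := by
  rw [← sub_mul_chordSlope, map_mul, Complex.conj_ofReal, mul_assoc,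
    Complex.arg_real_mul _ (sub_pos.2 h), angleIn]

theorem arg_mem_Ioo_of_im_pos {z : ℂ} (h : 0 < z.im) : z.arg ∈ Ioo 0 Real.pi := by
  refine ⟨(Complex.arg_nonneg_iff.2 h.le).lt_of_ne fun h0 => ?_, ?_⟩
  · have := (Complex.arg_eq_zero_iff.1 h0.symm).2
    linarith
  · refine Complex.arg_lt_pi_iff.2 (Or.inr h.ne')

theorem angleOut_mem (h : t ∈ Ioo s (s + D.length)) : D.angleOut s t ∈ Ioo 0 Real.pi := by
  rw [angleOut_eq_arg h.1]; exact arg_mem_Ioo_of_im_pos (chord_mul_conj_im_pos h)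

theorem angleIn_mem (h : t ∈ Ioo s (s + D.length)) : D.angleIn s t ∈ Ioo 0 Real.pi := by
  rw [angleIn_eq_arg h.1]; exact arg_mem_Ioo_of_im_pos (conj_chord_mul_im_pos h)

/-- The diagonal is included: the value there is `1`, off the cut of `arg`. -/
theorem chordSlope_mul_conj_mem_slitPlane (h : t ∈ Ico s (s + D.length)) :
    D.chordSlope s t * (starRingEnd ℂ) (deriv D.γ s) ∈ Complex.slitPlane := by
  rcases h.1.eq_or_lt with rfl | h'
  · rw [chordSlope_self, deriv_mul_conj]; exact Complex.one_mem_slitPlane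
  · have := chord_mul_conj_im_pos (D := D) ⟨h', h.2⟩
    rw [← sub_mul_chordSlope, mul_assoc, Complex.im_ofReal_mul] at this
    exact Or.inr (pos_of_mul_pos_right this (sub_pos.2 h').le).ne'

theorem conj_chordSlope_mul_mem_slitPlane (h : t ∈ Ico s (s + D.length)) :
    (starRingEnd ℂ) (D.chordSlope s t) * deriv D.γ t ∈ Complex.slitPlane := by
  rcases h.1.eq_or_lt with rfl | h'
  · rw [chordSlope_self, mul_comm, deriv_mul_conj]; exact Complex.one_mem_slitPlane
  · have := conj_chord_mul_im_pos (D := D) ⟨h', h.2⟩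
    rw [← sub_mul_chordSlope, map_mul, Complex.conj_ofReal, mul_assoc, Complex.im_ofReal_mul] at this
    exact Or.inr (pos_of_mul_pos_right this (sub_pos.2 h').le).ne'

theorem continuousAt_angleOut {p : ℝ × ℝ} (h : p.2 ∈ Ico p.1 (p.1 + D.length)) :
    ContinuousAt (fun p : ℝ × ℝ => D.angleOut p.1 p.2) p := by
  have h1 : Continuous fun p : ℝ × ℝ => D.chordSlope p.1 p.2 * (starRingEnd ℂ) (deriv D.γ p.1) :=
    D.continuous_chordSlope.mul (Complex.continuous_conj.comp (D.continuous_deriv.comp continuous_fst))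
  exact (Complex.continuousAt_arg (chordSlope_mul_conj_mem_slitPlane h)).comp_of_eq
    h1.continuousAt rfl

theorem continuousAt_angleIn {p : ℝ × ℝ} (h : p.2 ∈ Ico p.1 (p.1 + D.length)) :
    ContinuousAt (fun p : ℝ × ℝ => D.angleIn p.1 p.2) p := by
  have h1 : Continuous fun p : ℝ × ℝ => (starRingEnd ℂ) (D.chordSlope p.1 p.2) * deriv D.γ p.2 :=
    (Complex.continuous_conj.comp D.continuous_chordSlope).mul (D.continuous_deriv.comp continuous_snd)
  exact (Complex.continuousAt_arg (conj_chordSlope_mul_mem_slitPlane h)).comp_of_eq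
    h1.continuousAt rfl

theorem sin_angleOut (h : t ∈ Ioo s (s + D.length)) :
    Real.sin (D.angleOut s t) =
      ((D.γ t - D.γ s) * (starRingEnd ℂ) (deriv D.γ s)).im / ‖D.γ t - D.γ s‖ := by
  rw [angleOut_eq_arg h.1, Complex.sin_arg, norm_mul, RCLike.norm_conj, D.unit_speed, mul_one]

theorem sin_angleIn (h : t ∈ Ioo s (s + D.length)) :
    Real.sin (D.angleIn s t) =
      ((starRingEnd ℂ) (D.γ t - D.γ s) * deriv D.γ t).im / ‖D.γ t - D.γ s‖ := by
  rw [angleIn_eq_arg h.1, Complex.sin_arg, norm_mul, RCLike.norm_conj, D.unit_speed, mul_one]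

theorem _root_.HasDerivAt.arg_real {z : ℝ → ℂ} {z' : ℂ} {t : ℝ} (h : HasDerivAt z z' t)
    (h0 : z t ∈ Complex.slitPlane) : HasDerivAt (fun t => (z t).arg) (z' / z t).im t := by
  have h1 := h.clog_real h0
  have h2 := (Complex.imCLM.hasFDerivAt.comp_hasDerivAt t h1)
  simpa [Function.comp_def, Complex.log_im] using h2

theorem eventually_lt_fst_snd (h : s < t) : ∀ᶠ p : ℝ × ℝ in 𝓝 (s, t), p.1 < p.2 :=
  (isOpen_lt continuous_fst continuous_snd).mem_nhds h

/-- The derivative of `arg z` is `Im (z' / z)`. The fixed tangent at `s` cancels, leaving the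
turning rate of the chord: the component of `γ' t` normal to the chord over the chord length. -/
theorem hasDerivAt_angleOut (h : t ∈ Ioo s (s + D.length)) :
    HasDerivAt (fun t => D.angleOut s t) (Real.sin (D.angleIn s t) / ‖D.γ t - D.γ s‖) t := by
  have h1 : HasDerivAt (fun t => (D.γ t - D.γ s) * (starRingEnd ℂ) (deriv D.γ s))
      (deriv D.γ t * (starRingEnd ℂ) (deriv D.γ s)) t :=
    ((D.hasDerivAt t).sub_const _).mul_const _
  have h2 := h1.arg_real (Or.inr (chord_mul_conj_im_pos h).ne')
  have h3 : (deriv D.γ t * (starRingEnd ℂ) (deriv D.γ s) /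
      ((D.γ t - D.γ s) * (starRingEnd ℂ) (deriv D.γ s))).im
        = Real.sin (D.angleIn s t) / ‖D.γ t - D.γ s‖ := by
    rw [mul_div_mul_right _ _ ((map_ne_zero _).2 (D.deriv_ne_zero s)), sin_angleIn h, div_div,
      ← sq, ← Complex.normSq_eq_norm_sq, mul_comm, div_eq_mul_inv, Complex.inv_def, ← mul_assoc,
      Complex.im_mul_ofReal, div_eq_mul_inv]
  rw [h3] at h2
  refine h2.congr_of_eventuallyEq ?_
  filter_upwards [lt_mem_nhds h.1] with u hu
  exact angleOut_eq_arg hu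

/-- The mirror image of `hasDerivAt_angleOut`. The two derivatives differ by the exchange of the
sines and the sign; this symmetry is the source of area preservation in
`NormalizedIntegral.hasDerivAt_level`. -/
theorem hasDerivAt_angleIn (h : t ∈ Ioo s (s + D.length)) :
    HasDerivAt (fun s => D.angleIn s t) (-(Real.sin (D.angleOut s t) / ‖D.γ t - D.γ s‖)) s := by
  have h0 : HasDerivAt (fun s => (starRingEnd ℂ) (D.γ t - D.γ s))
      (-(starRingEnd ℂ) (deriv D.γ s)) s := by
    have := (Complex.conjCLE.toContinuousLinearMap.hasFDerivAt.comp_hasDerivAt s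
      ((D.hasDerivAt s).const_sub (D.γ t)))
    simpa [Function.comp_def] using this
  have h1 : HasDerivAt (fun s => (starRingEnd ℂ) (D.γ t - D.γ s) * deriv D.γ t)
      (-(starRingEnd ℂ) (deriv D.γ s) * deriv D.γ t) s := h0.mul_const _
  have h2 := h1.arg_real (Or.inr (conj_chord_mul_im_pos h).ne')
  have h3 : (-(starRingEnd ℂ) (deriv D.γ s) * deriv D.γ t /
      ((starRingEnd ℂ) (D.γ t - D.γ s) * deriv D.γ t)).im
        = -(Real.sin (D.angleOut s t) / ‖D.γ t - D.γ s‖) := by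
    rw [mul_div_mul_right _ _ (D.deriv_ne_zero t), sin_angleOut h, div_div,
      ← sq, ← Complex.normSq_eq_norm_sq, div_eq_mul_inv, Complex.inv_def, Complex.conj_conj,
      Complex.normSq_conj, ← mul_assoc, Complex.im_mul_ofReal, div_eq_mul_inv, neg_mul,
      Complex.neg_im, neg_mul, mul_comm ((starRingEnd ℂ) (deriv D.γ s))]
  rw [h3] at h2
  refine h2.congr_of_eventuallyEq ?_
  filter_upwards [gt_mem_nhds h.1] with u hu
  exact angleIn_eq_arg hu

theorem differentiableAt_angleOut (h : t ∈ Ioo s (s + D.length)) :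
    DifferentiableAt ℝ (fun p : ℝ × ℝ => D.angleOut p.1 p.2) (s, t) := by
  have hγ : Differentiable ℝ D.γ := D.contDiff.differentiable (by norm_num)
  have hγ' : Differentiable ℝ (deriv D.γ) := D.contDiff_deriv.differentiable (by norm_num)
  have h1 : DifferentiableAt ℝ
      (fun p : ℝ × ℝ => (D.γ p.2 - D.γ p.1) * (starRingEnd ℂ) (deriv D.γ p.1)) (s, t) := by
    have h2 : Differentiable ℝ (fun p : ℝ × ℝ => (starRingEnd ℂ) (deriv D.γ p.1)) :=
      Complex.conjCLE.differentiable.comp (hγ'.comp differentiable_fst)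
    have h3 : Differentiable ℝ (fun p : ℝ × ℝ => (D.γ p.2 - D.γ p.1)) :=
      (hγ.comp differentiable_snd).sub (hγ.comp differentiable_fst)
    exact (h3.mul h2) _
  have h4 : DifferentiableAt ℝ Complex.log ((D.γ t - D.γ s) * (starRingEnd ℂ) (deriv D.γ s)) :=
    (Complex.differentiableAt_log (Or.inr (chord_mul_conj_im_pos h).ne')).restrictScalars ℝ
  have h5 : DifferentiableAt ℝ (fun p : ℝ × ℝ =>
      ((D.γ p.2 - D.γ p.1) * (starRingEnd ℂ) (deriv D.γ p.1)).arg) (s, t) := by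
    have := Complex.imCLM.differentiableAt.comp (s, t) (DifferentiableAt.comp (f := fun p : ℝ × ℝ =>
      (D.γ p.2 - D.γ p.1) * (starRingEnd ℂ) (deriv D.γ p.1)) (s, t) h4 h1)
    simpa [Function.comp_def, Complex.log_im] using this
  refine h5.congr_of_eventuallyEq ?_
  filter_upwards [eventually_lt_fst_snd h.1] with p hp
  exact angleOut_eq_arg hp

theorem strictMonoOn_angleOut (s : ℝ) : StrictMonoOn (D.angleOut s) (Ico s (s + D.length)) := by
  refine strictMonoOn_of_deriv_pos (convex_Ico _ _) (fun t ht => ?_) fun t ht => ?_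
  · exact ((continuousAt_angleOut (p := (s, t)) ht).comp (f := fun t : ℝ => (s, t))
      (by fun_prop)).continuousWithinAt
  · rw [interior_Ico] at ht
    rw [(hasDerivAt_angleOut ht).deriv]
    exact div_pos (Real.sin_pos_of_mem_Ioo (angleIn_mem ht)) (norm_pos_iff.2 (chord_ne_zero ht))

variable (D)

/-- The point of the closed phase annulus with lifted coordinates `(s, φ)`; angles outside
`[0, π]` are projected. -/
noncomputable def phase (s φ : ℝ) : D.Phase :=
  ((s : AddCircle D.length), projIcc 0 Real.pi Real.pi_pos.le φ)

variable {D}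

theorem phase_snd {φ : ℝ} (h : φ ∈ Icc 0 Real.pi) : ((D.phase s φ).2 : ℝ) = φ := by
  simp [phase, projIcc_of_mem _ h]

theorem exists_lift (p : D.Phase) : ∃ s, p = D.phase s p.2 := by
  obtain ⟨a, φ⟩ := p
  induction a using QuotientAddGroup.induction_on with
  | H s => exact ⟨s, by simp [phase, projIcc_val]⟩

theorem bounce_phase (h : t ∈ Ioo s (s + D.length)) :
    D.Bounce (D.phase s (D.angleOut s t)) (D.phase t (D.angleIn s t)) := by
  have h0 := Ioo_subset_Icc_self (angleOut_mem h)
  have h1 := Ioo_subset_Icc_self (angleIn_mem h)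
  refine ⟨‖D.γ t - D.γ s‖, norm_pos_iff.2 (chord_ne_zero h), ?_, ?_⟩
  · rw [phase_snd h0]
    change D.point (t : AddCircle D.length) - D.point (s : AddCircle D.length) = _ * (_ *
      D.tangent (s : AddCircle D.length))
    rw [point_coe, point_coe, tangent_coe, ← mul_assoc, angleOut_eq_arg h.1]
    have h2 := Complex.norm_mul_exp_arg_mul_I
      ((D.γ t - D.γ s) * (starRingEnd ℂ) (deriv D.γ s))
    rw [norm_mul, RCLike.norm_conj, D.unit_speed, mul_one] at h2
    rw [h2, mul_assoc, mul_comm _ (deriv D.γ s), deriv_mul_conj, mul_one]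
  · rw [phase_snd h1]
    change D.point (t : AddCircle D.length) - D.point (s : AddCircle D.length) = _ * (_ *
      D.tangent (t : AddCircle D.length))
    rw [point_coe, point_coe, tangent_coe, ← mul_assoc, angleIn_eq_arg h.1]
    have h2 := Complex.norm_mul_exp_arg_mul_I
      ((starRingEnd ℂ) (D.γ t - D.γ s) * deriv D.γ t)
    rw [norm_mul, RCLike.norm_conj, D.unit_speed, mul_one] at h2
    have h3 := congrArg (starRingEnd ℂ) h2
    simp only [map_mul, Complex.conj_ofReal, ← Complex.exp_conj, Complex.conj_I, Complex.conj_conj,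
      mul_neg] at h3
    rw [h3, mul_assoc, mul_comm _ (deriv D.γ t), deriv_mul_conj, mul_one]

/-- The foot point of `q` has a lift in the period that starts at `s`, and `r > 0` excludes `s`
itself. The two chord equations then give the two angles. -/
theorem Bounce.exists_lift {φ : ℝ} {q : D.Phase} (hφ : φ ∈ Ioo 0 Real.pi)
    (h : D.Bounce (D.phase s φ) q) :
    ∃ t ∈ Ioo s (s + D.length), D.angleOut s t = φ ∧ q = D.phase t (D.angleIn s t) := by
  obtain ⟨t₀, ht₀⟩ := StrictlyConvexTable.exists_lift q
  obtain ⟨r, hr, h1, h2⟩ := h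
  obtain ⟨n, hn, -⟩ := existsUnique_add_zsmul_mem_Ico D.length_pos t₀ s
  set t := t₀ + n • D.length with ht
  have hq : q = D.phase t q.2 := by
    rw [ht₀]
    ext1
    · simp [phase, ht]
    · simp [phase]
  rw [phase_snd (Ioo_subset_Icc_self hφ)] at h1
  have hq1 : q.1 = (t : AddCircle D.length) := congrArg Prod.fst hq
  change _ - D.point (s : AddCircle D.length) = _ * (_ * D.tangent (s : AddCircle D.length)) at h1
  change _ - D.point (s : AddCircle D.length) = _ at h2
  rw [hq1, point_coe, point_coe, tangent_coe] at h1 h2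
  have hst : s < t := by
    refine hn.1.lt_of_ne fun hst => ?_
    rw [← hst, sub_self] at h1
    have : (r : ℂ) * (Complex.exp (φ * Complex.I) * deriv D.γ s) ≠ 0 :=
      mul_ne_zero (by exact_mod_cast hr.ne') (mul_ne_zero (Complex.exp_ne_zero _) (D.deriv_ne_zero s))
    exact this h1.symm
  refine ⟨t, ⟨hst, hn.2⟩, ?_, ?_⟩
  · rw [angleOut_eq_arg hst, h1, mul_assoc, mul_assoc, deriv_mul_conj, mul_one,
      Complex.arg_real_mul _ hr, Complex.exp_mul_I,
      Complex.arg_cos_add_sin_mul_I ⟨by linarith [hφ.1, Real.pi_pos], hφ.2.le⟩]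
  · have h3 : D.angleIn s t = q.2 := by
      have h4 : (starRingEnd ℂ) (r * (Complex.exp (-((q.2 : ℝ) * Complex.I)) * deriv D.γ t)) =
          r * (Complex.exp ((q.2 : ℝ) * Complex.I) * (starRingEnd ℂ) (deriv D.γ t)) := by
        simp [← Complex.exp_conj]
      rw [angleIn_eq_arg hst, h2, h4, mul_assoc, mul_assoc, mul_comm _ (deriv D.γ t),
        deriv_mul_conj, mul_one, Complex.arg_real_mul _ hr, Complex.exp_mul_I,
        Complex.arg_cos_add_sin_mul_I ⟨by linarith [q.2.2.1, Real.pi_pos], q.2.2.2⟩]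
    rw [h3]; exact hq

/-- The map is defined by choice among all bounces. Strict monotonicity of `angleOut s` over one
period leaves only one candidate. -/
theorem billiardMap_phase (h : t ∈ Ioo s (s + D.length)) :
    D.billiardMap (D.phase s (D.angleOut s t)) = D.phase t (D.angleIn s t) := by
  have ha := angleOut_mem h
  have hex : ∃ q, D.Bounce (D.phase s (D.angleOut s t)) q := ⟨_, bounce_phase h⟩
  have hcond : (0 < ((D.phase s (D.angleOut s t)).2 : ℝ) ∧
      ((D.phase s (D.angleOut s t)).2 : ℝ) < Real.pi) ∧
      ∃ q, D.Bounce (D.phase s (D.angleOut s t)) q := by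
    rw [phase_snd (Ioo_subset_Icc_self ha)]
    exact ⟨ha, hex⟩
  rw [billiardMap, dif_pos hcond]
  obtain ⟨t', ht', h1, h2⟩ := Bounce.exists_lift ha hcond.2.choose_spec
  have : t' = t := (strictMonoOn_angleOut s).injOn (Ioo_subset_Ico_self ht')
    (Ioo_subset_Ico_self h) h1
  rw [h2, this]

theorem billiardMap_of_snd_eq_zero {p : D.Phase} (h : (p.2 : ℝ) = 0) : D.billiardMap p = p := by
  rw [billiardMap, dif_neg]
  rintro ⟨⟨h1, -⟩, -⟩
  exact h1.ne' h

end StrictlyConvexTable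

/-! ### Taylor expansions with remainders uniform in the base point. -/

theorem uniform_taylor_zero {E : Type*} [NormedAddCommGroup E] {f : ℝ → E}
    (hf : UniformContinuous f) :
    ∀ ε > 0, ∃ η > 0, ∀ s t : ℝ, |t| < η → ‖f (s + t) - f s‖ ≤ ε * |t| ^ 0 := by
  intro ε hε
  obtain ⟨η, hη, h⟩ := Metric.uniformContinuous_iff.1 hf ε hε
  refine ⟨η, hη, fun s t ht => ?_⟩
  have := h (a := s + t) (b := s) (by simpa [Real.dist_eq] using ht)
  rw [dist_eq_norm] at this
  simpa using this.le

section

variable {E : Type*} [NormedAddCommGroup E] [NormedSpace ℝ E] {f f₁ f₂ f₃ : ℝ → E}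

theorem hasDerivAt_comp_const_add' {f : ℝ → E} {f' : ℝ → E} (h : ∀ s, HasDerivAt f (f' s) s)
    (s t : ℝ) : HasDerivAt (fun t => f (s + t)) (f' (s + t)) t := by
  simpa using (h (s + t)).comp_const_add s t

/-- The derivative in `t` of each remainder is the remainder of one order less for the derivative of
`f`; `uniform_remainder_step` integrates it. -/
theorem uniform_taylor_one (h₁ : ∀ s, HasDerivAt f (f₁ s) s) (hu : UniformContinuous f₁) :
    ∀ ε > 0, ∃ η > 0, ∀ s t : ℝ, |t| < η → ‖f (s + t) - f s - t • f₁ s‖ ≤ ε * |t| ^ 1 :=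
  uniform_remainder_step (n := 0) (r := fun s t => f (s + t) - f s - t • f₁ s)
    (fun s t => by
      have := ((hasDerivAt_comp_const_add' h₁ s t).sub_const (f s)).fun_sub
        ((hasDerivAt_id t).smul_const (f₁ s))
      simpa using this) (fun s => by simp) (uniform_taylor_zero hu)

theorem uniform_taylor_two (h₁ : ∀ s, HasDerivAt f (f₁ s) s) (h₂ : ∀ s, HasDerivAt f₁ (f₂ s) s)
    (hu : UniformContinuous f₂) :
    ∀ ε > 0, ∃ η > 0, ∀ s t : ℝ, |t| < η →
      ‖f (s + t) - f s - t • f₁ s - (t ^ 2 / 2) • f₂ s‖ ≤ ε * |t| ^ 2 :=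
  uniform_remainder_step (n := 1) (r := fun s t => f (s + t) - f s - t • f₁ s - (t ^ 2 / 2) • f₂ s)
    (fun s t => by
      have h3 : HasDerivAt (fun t : ℝ => t ^ 2 / 2) t t := by
        have := ((hasDerivAt_id t).pow 2).div_const 2
        simpa using this
      have := (((hasDerivAt_comp_const_add' h₁ s t).sub_const (f s)).fun_sub
        ((hasDerivAt_id t).smul_const (f₁ s))).fun_sub (h3.smul_const (f₂ s))
      simpa using this) (fun s => by simp) (uniform_taylor_one h₂ hu)

theorem uniform_taylor_three (h₁ : ∀ s, HasDerivAt f (f₁ s) s) (h₂ : ∀ s, HasDerivAt f₁ (f₂ s) s)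
    (h₃ : ∀ s, HasDerivAt f₂ (f₃ s) s) (hu : UniformContinuous f₃) :
    ∀ ε > 0, ∃ η > 0, ∀ s t : ℝ, |t| < η →
      ‖f (s + t) - f s - t • f₁ s - (t ^ 2 / 2) • f₂ s - (t ^ 3 / 6) • f₃ s‖ ≤ ε * |t| ^ 3 :=
  uniform_remainder_step (n := 2)
    (r := fun s t => f (s + t) - f s - t • f₁ s - (t ^ 2 / 2) • f₂ s - (t ^ 3 / 6) • f₃ s)
    (fun s t => by
      have h4 : HasDerivAt (fun t : ℝ => t ^ 2 / 2) t t := by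
        have := ((hasDerivAt_id t).pow 2).div_const 2
        simpa using this
      have h5 : HasDerivAt (fun t : ℝ => t ^ 3 / 6) (t ^ 2 / 2) t := by
        refine ((hasDerivAt_pow 3 t).div_const 6).congr_deriv ?_
        change ((3 : ℕ) : ℝ) * t ^ 2 / 6 = t ^ 2 / 2
        push_cast; ring
      have := ((((hasDerivAt_comp_const_add' h₁ s t).sub_const (f s)).fun_sub
        ((hasDerivAt_id t).smul_const (f₁ s))).fun_sub (h4.smul_const (f₂ s))).fun_sub
        (h5.smul_const (f₃ s))
      simpa using this) (fun s => by simp) (uniform_taylor_two h₂ h₃ hu)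

end

/-! ### The Lazutkin coordinate and the second differences of short trajectories. -/

namespace StrictlyConvexTable

variable (D : StrictlyConvexTable)

/-- The curvature of the boundary. -/
noncomputable def curvature (s : ℝ) : ℝ :=
  ((starRingEnd ℂ) (deriv D.γ s) * deriv (deriv D.γ) s).im

theorem zero_lt_curvature (s : ℝ) : 0 < D.curvature s := D.curvature_pos s

theorem contDiff_deriv_deriv : ContDiff ℝ 1 (deriv (deriv D.γ)) := D.contDiff_deriv.deriv' (n := 1)

theorem hasDerivAt_deriv (s : ℝ) : HasDerivAt (deriv D.γ) (deriv (deriv D.γ) s) s :=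
  (D.contDiff_deriv.differentiable (by norm_num) s).hasDerivAt

theorem hasDerivAt_deriv_deriv (s : ℝ) :
    HasDerivAt (deriv (deriv D.γ)) (deriv (deriv (deriv D.γ)) s) s :=
  (D.contDiff_deriv_deriv.differentiable (by norm_num) s).hasDerivAt

theorem _root_.Function.Periodic.deriv' {f : ℝ → ℂ} {l : ℝ} (h : Function.Periodic f l) :
    Function.Periodic (deriv f) l := by
  intro s
  have h' : (fun x => f (x + l)) = f := funext h
  rw [← deriv_comp_add_const, h']

theorem continuous_deriv_deriv_deriv : Continuous (deriv (deriv (deriv D.γ))) :=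
  D.contDiff_deriv_deriv.continuous_deriv le_rfl

theorem contDiff_curvature : ContDiff ℝ 1 D.curvature := by
  have h1 : ContDiff ℝ 1 fun s => (starRingEnd ℂ) (deriv D.γ s) :=
    Complex.conjCLE.contDiff.comp (D.contDiff_deriv.of_le (by norm_num))
  exact Complex.imCLM.contDiff.comp (h1.mul D.contDiff_deriv_deriv)

theorem curvature_periodic : Function.Periodic D.curvature D.length := by
  intro s
  rw [curvature, curvature, D.periodic_deriv, D.periodic_deriv.deriv']

/-- Differentiate `γ' * conj γ' = 1`. -/
theorem re_conj_deriv_mul_deriv_deriv (s : ℝ) :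
    ((starRingEnd ℂ) (deriv D.γ s) * deriv (deriv D.γ) s).re = 0 := by
  have h1 : HasDerivAt (fun s => (starRingEnd ℂ) (deriv D.γ s))
      ((starRingEnd ℂ) (deriv (deriv D.γ) s)) s := by
    have := Complex.conjCLE.toContinuousLinearMap.hasFDerivAt.comp_hasDerivAt s (D.hasDerivAt_deriv s)
    simpa [Function.comp_def] using this
  have h2 := (D.hasDerivAt_deriv s).mul h1
  have h3 : (fun s => deriv D.γ s * (starRingEnd ℂ) (deriv D.γ s)) = fun _ => 1 :=
    funext D.deriv_mul_conj
  have h4 := h2.unique (by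
    change HasDerivAt (fun s => deriv D.γ s * (starRingEnd ℂ) (deriv D.γ s)) 0 s
    rw [h3]; exact hasDerivAt_const s (1 : ℂ))
  have h5 := congrArg Complex.re h4
  simp only [Complex.add_re, Complex.mul_re, Complex.conj_re, Complex.conj_im, Complex.zero_re] at h5 ⊢
  linarith

theorem hasDerivAt_curvature (s : ℝ) : HasDerivAt D.curvature
    ((starRingEnd ℂ) (deriv D.γ s) * deriv (deriv (deriv D.γ)) s).im s := by
  have h1 : HasDerivAt (fun s => (starRingEnd ℂ) (deriv D.γ s))
      ((starRingEnd ℂ) (deriv (deriv D.γ) s)) s := by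
    have := Complex.conjCLE.toContinuousLinearMap.hasFDerivAt.comp_hasDerivAt s (D.hasDerivAt_deriv s)
    simpa [Function.comp_def] using this
  have h2 := Complex.imCLM.hasFDerivAt.comp_hasDerivAt s (h1.mul (D.hasDerivAt_deriv_deriv s))
  have h3 : Complex.imCLM ((starRingEnd ℂ) (deriv (deriv D.γ) s) * deriv (deriv D.γ) s +
      (starRingEnd ℂ) (deriv D.γ s) * deriv (deriv (deriv D.γ)) s) =
      ((starRingEnd ℂ) (deriv D.γ s) * deriv (deriv (deriv D.γ)) s).im := by
    simp only [Complex.imCLM_apply, Complex.add_im, Complex.mul_im, Complex.conj_re, Complex.conj_im]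
    ring
  rw [h3] at h2
  exact h2

/-- The cube root of the curvature. -/
noncomputable def cbrtCurvature (s : ℝ) : ℝ := D.curvature s ^ (1 / 3 : ℝ)

theorem cbrtCurvature_pos (s : ℝ) : 0 < D.cbrtCurvature s :=
  Real.rpow_pos_of_pos (D.zero_lt_curvature s) _

theorem cbrtCurvature_pow (s : ℝ) : D.cbrtCurvature s ^ 3 = D.curvature s := by
  rw [cbrtCurvature, ← Real.rpow_natCast, ← Real.rpow_mul (D.zero_lt_curvature s).le]
  norm_num

theorem contDiff_cbrtCurvature : ContDiff ℝ 1 D.cbrtCurvature :=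
  D.contDiff_curvature.rpow_const_of_ne fun s => (D.zero_lt_curvature s).ne'

theorem hasDerivAt_cbrtCurvature (s : ℝ) :
    HasDerivAt D.cbrtCurvature (deriv D.cbrtCurvature s) s :=
  (D.contDiff_cbrtCurvature.differentiable (by norm_num) s).hasDerivAt

/-- With `k` the cube root of the curvature, the Lazutkin density is proportional to `k ^ 2` and the
derivative of the curvature is `3 k² k'`, so the expansions below are rational in `k` and `k'`. -/
theorem three_mul_sq_cbrtCurvature (s : ℝ) :
    3 * D.cbrtCurvature s ^ 2 * deriv D.cbrtCurvature s =
      ((starRingEnd ℂ) (deriv D.γ s) * deriv (deriv (deriv D.γ)) s).im := by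
  have h1 := (D.hasDerivAt_cbrtCurvature s).pow 3
  have h2 : D.cbrtCurvature ^ 3 = D.curvature := funext D.cbrtCurvature_pow
  rw [h2] at h1
  simpa using h1.unique (D.hasDerivAt_curvature s)

theorem cbrtCurvature_periodic : Function.Periodic D.cbrtCurvature D.length := by
  intro s
  rw [cbrtCurvature, cbrtCurvature, D.curvature_periodic]

theorem continuous_sq_cbrtCurvature : Continuous fun s => D.cbrtCurvature s ^ 2 :=
  D.contDiff_cbrtCurvature.continuous.pow 2

/-- The integral of the `2/3`-th power of the curvature over the boundary. -/
noncomputable def lazutkinLength : ℝ := ∫ s in (0 : ℝ)..D.length, D.cbrtCurvature s ^ 2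

theorem lazutkinLength_pos : 0 < D.lazutkinLength :=
  intervalIntegral.intervalIntegral_pos_of_pos
    (D.continuous_sq_cbrtCurvature.intervalIntegrable _ _)
    (fun s => pow_pos (D.cbrtCurvature_pos s) 2) D.length_pos

/-- The Lazutkin coordinate on the boundary, normalized to total length one. -/
noncomputable def lazutkin (s : ℝ) : ℝ :=
  (∫ t in (0 : ℝ)..s, D.cbrtCurvature t ^ 2) / D.lazutkinLength

theorem lazutkin_zero : D.lazutkin 0 = 0 := by simp [lazutkin]

theorem lazutkin_length : D.lazutkin D.length = 1 := div_self D.lazutkinLength_pos.ne'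

theorem hasDerivAt_lazutkin (s : ℝ) :
    HasDerivAt D.lazutkin (D.cbrtCurvature s ^ 2 / D.lazutkinLength) s :=
  (D.continuous_sq_cbrtCurvature.integral_hasStrictDerivAt 0 s).hasDerivAt.div_const _

theorem lazutkin_add_length (s : ℝ) : D.lazutkin (s + D.length) = D.lazutkin s + 1 := by
  have h1 := intervalIntegral.integral_add_adjacent_intervals
    (D.continuous_sq_cbrtCurvature.intervalIntegrable (μ := MeasureTheory.volume) 0 s)
    (D.continuous_sq_cbrtCurvature.intervalIntegrable s (s + D.length))
  have hp : Function.Periodic (fun s => D.cbrtCurvature s ^ 2) D.length := fun s => by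
    simp only [D.cbrtCurvature_periodic s]
  have h2 := hp.intervalIntegral_add_eq s 0
  rw [zero_add] at h2
  rw [lazutkin, ← h1, h2, add_div, lazutkin]
  congr 1
  exact D.lazutkin_length

theorem continuous_lazutkin : Continuous D.lazutkin :=
  continuous_iff_continuousAt.2 fun s => (D.hasDerivAt_lazutkin s).continuousAt

theorem strictMono_lazutkin : StrictMono D.lazutkin :=
  strictMono_of_deriv_pos fun s => by
    rw [(D.hasDerivAt_lazutkin s).deriv]
    exact div_pos (pow_pos (D.cbrtCurvature_pos s) 2) D.lazutkinLength_pos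

theorem exists_le_lazutkin_sub : ∃ m > 0, ∀ s t, s ≤ t → m * (t - s) ≤ D.lazutkin t - D.lazutkin s := by
  have hL := D.lazutkinLength_pos
  obtain ⟨m, hm, h⟩ := exists_pos_le_of_periodic (f := fun s => D.cbrtCurvature s ^ 2 / D.lazutkinLength)
    D.length_pos (D.continuous_sq_cbrtCurvature.div_const _)
    (fun s => by simp only [D.cbrtCurvature_periodic s])
    (fun s => div_pos (pow_pos (D.cbrtCurvature_pos s) 2) hL)
  refine ⟨m, hm, fun s t hst => ?_⟩
  exact mul_sub_le_image_sub_of_le_deriv (fun s => (D.hasDerivAt_lazutkin s).differentiableAt)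
    (fun s => by rw [(D.hasDerivAt_lazutkin s).deriv]; exact h s) hst

theorem exists_lazutkin_sub_le : ∃ M, ∀ s t, |D.lazutkin (s + t) - D.lazutkin s| ≤ M * |t| := by
  obtain ⟨M, h⟩ := exists_abs_le_of_periodic (f := fun s => D.cbrtCurvature s ^ 2 / D.lazutkinLength)
    D.length_pos (D.continuous_sq_cbrtCurvature.div_const _)
    (fun s => by simp only [D.cbrtCurvature_periodic s])
  refine ⟨M, fun s t => ?_⟩
  have := Convex.norm_image_sub_le_of_norm_hasDerivWithin_le (s := univ) (f := D.lazutkin)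
    (C := M) (x := s) (y := s + t) (fun v _ => (D.hasDerivAt_lazutkin v).hasDerivWithinAt)
    (fun v _ => h v) convex_univ (mem_univ _) (mem_univ _)
  simpa using this

/-- The chord vector from `γ s` to `γ (s + t)` in the frame of the tangent at `γ s`. -/
noncomputable def chordInFrame (s t : ℝ) : ℂ :=
  (D.γ (s + t) - D.γ s) * (starRingEnd ℂ) (deriv D.γ s)

/-- `γ'' * conj γ'` is purely imaginary, so the real part has no `t ^ 2` term. The precision `o(t ^
2)` suffices there because the real part gets multiplied by a Lazutkin step of order `t`; the
imaginary part needs the full third-order expansion. -/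
theorem chordInFrame_estimate : ∀ ε > 0, ∃ η > 0, ∀ s t : ℝ, |t| < η →
    |(D.chordInFrame s t).re - t| ≤ ε * |t| ^ 2 ∧
    |(D.chordInFrame s t).im - (D.curvature s * t ^ 2 / 2 +
      ((starRingEnd ℂ) (deriv D.γ s) * deriv (deriv (deriv D.γ)) s).im * t ^ 3 / 6)|
        ≤ ε * |t| ^ 3 := by
  intro ε hε
  obtain ⟨C, hC⟩ := exists_abs_le_of_periodic (f := fun s => ‖deriv (deriv (deriv D.γ)) s‖)
    D.length_pos D.continuous_deriv_deriv_deriv.norm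
    (fun s => by simp only [D.periodic_deriv.deriv'.deriv' s])
  have hC0 : 0 ≤ C := (abs_nonneg _).trans (hC 0)
  obtain ⟨η, hη, h⟩ := uniform_taylor_three D.hasDerivAt D.hasDerivAt_deriv D.hasDerivAt_deriv_deriv
    (uniformContinuous_of_periodic D.length_pos D.continuous_deriv_deriv_deriv
      D.periodic_deriv.deriv'.deriv') ε hε
  -- The second bound gives `(ε + C) * |t| ≤ ε`, which turns the cubic terms of the real part into
  -- `ε * |t| ^ 2`.
  refine ⟨min η (ε / (ε + C)), by positivity, fun s t ht => ?_⟩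
  have hr := h s t (ht.trans_le (min_le_left _ _))
  set r := D.γ (s + t) - D.γ s - t • deriv D.γ s - (t ^ 2 / 2) • deriv (deriv D.γ) s -
    (t ^ 3 / 6) • deriv (deriv (deriv D.γ)) s with hr_def
  have hrT : ‖r * (starRingEnd ℂ) (deriv D.γ s)‖ ≤ ε * |t| ^ 3 := by
    rwa [norm_mul, RCLike.norm_conj, D.unit_speed, mul_one]
  have hexp : D.chordInFrame s t = r * (starRingEnd ℂ) (deriv D.γ s) + (t : ℂ) +
      ((t ^ 2 / 2 : ℝ) : ℂ) * ((starRingEnd ℂ) (deriv D.γ s) * deriv (deriv D.γ) s) +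
      ((t ^ 3 / 6 : ℝ) : ℂ) * ((starRingEnd ℂ) (deriv D.γ s) * deriv (deriv (deriv D.γ)) s) := by
    rw [hr_def, chordInFrame]
    simp only [Complex.real_smul]
    linear_combination (t : ℂ) * D.deriv_mul_conj s
  constructor
  · rw [hexp]
    simp only [Complex.add_re, Complex.re_ofReal_mul, Complex.ofReal_re,
      re_conj_deriv_mul_deriv_deriv, mul_zero, add_zero]
    have h1 := (Complex.abs_re_le_norm _).trans hrT
    have h2 : |((starRingEnd ℂ) (deriv D.γ s) * deriv (deriv (deriv D.γ)) s).re| ≤ C := by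
      refine (Complex.abs_re_le_norm _).trans ?_
      rw [norm_mul, RCLike.norm_conj, D.unit_speed, one_mul]
      exact (le_abs_self _).trans (hC s)
    have h3 : |t ^ 3 / 6 * ((starRingEnd ℂ) (deriv D.γ s) * deriv (deriv (deriv D.γ)) s).re|
        ≤ C * |t| ^ 3 := by
      rw [abs_mul, abs_div, abs_pow, abs_of_pos (by norm_num : (0 : ℝ) < 6), mul_comm]
      gcongr
      have : (0 : ℝ) ≤ |t| ^ 3 := by positivity
      linarith
    have h4 : (ε + C) * |t| ≤ ε := by
      have := (ht.trans_le (min_le_right _ _)).le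
      rwa [le_div_iff₀ (by positivity), mul_comm] at this
    have h5 : (ε + C) * |t| ^ 3 ≤ ε * |t| ^ 2 := by
      calc (ε + C) * |t| ^ 3 = ((ε + C) * |t|) * |t| ^ 2 := by ring
        _ ≤ _ := by gcongr
    calc _ = |(r * (starRingEnd ℂ) (deriv D.γ s)).re +
          t ^ 3 / 6 * ((starRingEnd ℂ) (deriv D.γ s) * deriv (deriv (deriv D.γ)) s).re| := by
          congr 1; ring
      _ ≤ _ := (abs_add_le _ _).trans (by linarith)
  · rw [hexp]
    simp only [Complex.add_im, Complex.im_ofReal_mul, Complex.ofReal_im]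
    refine le_trans (le_of_eq ?_) ((Complex.abs_im_le_norm _).trans hrT)
    congr 1
    rw [curvature]; ring

/-- In the Lazutkin coordinate, the length of a short chord is proportional to the tangent of its
angle up to an error of third order, with a factor that depends on the foot point only. -/
theorem lazutkin_estimate : ∀ ε > 0, ∃ η > 0, ∀ s t : ℝ, |t| < η →
    |(D.lazutkin (s + t) - D.lazutkin s) * (D.chordInFrame s t).re -
      2 / (D.lazutkinLength * D.cbrtCurvature s) * (D.chordInFrame s t).im| ≤ ε * |t| ^ 3 := by
  intro ε hε
  have hL := D.lazutkinLength_pos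
  have hkc : Continuous D.cbrtCurvature := D.contDiff_cbrtCurvature.continuous
  obtain ⟨C, hC⟩ := exists_abs_le_of_periodic
    (f := fun s => 2 / (D.lazutkinLength * D.cbrtCurvature s)) D.length_pos
    (continuous_const.div (continuous_const.mul hkc)
      fun s => (mul_pos hL (D.cbrtCurvature_pos s)).ne')
    (fun s => by simp only [D.cbrtCurvature_periodic s])
  obtain ⟨M, hM⟩ := D.exists_lazutkin_sub_le
  have hM0 : 0 ≤ M := by simpa using (abs_nonneg _).trans (hM 0 1)
  have hC0 : 0 ≤ C := (abs_nonneg _).trans (hC 0)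
  set ε' := ε / (1 + M + C) with hε'
  have hε'0 : 0 < ε' := by positivity
  have hk' : Continuous (deriv D.cbrtCurvature) := D.contDiff_cbrtCurvature.continuous_deriv le_rfl
  have hkp : Function.Periodic (deriv D.cbrtCurvature) D.length := by
    intro s
    have h' : (fun x => D.cbrtCurvature (x + D.length)) = D.cbrtCurvature :=
      funext D.cbrtCurvature_periodic
    rw [← deriv_comp_add_const, h']
  obtain ⟨η₁, hη₁, h1⟩ := uniform_taylor_two (f := D.lazutkin)
    (f₂ := fun s => 2 * D.cbrtCurvature s * deriv D.cbrtCurvature s / D.lazutkinLength)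
    D.hasDerivAt_lazutkin
    (fun s => by
      have := ((D.hasDerivAt_cbrtCurvature s).pow 2).div_const D.lazutkinLength
      simpa using this)
    (uniformContinuous_of_periodic D.length_pos (by fun_prop)
      (fun s => by simp only [D.cbrtCurvature_periodic s, hkp s])) ε' hε'0
  obtain ⟨η₂, hη₂, h2⟩ := D.chordInFrame_estimate ε' hε'0
  refine ⟨min η₁ η₂, lt_min hη₁ hη₂, fun s t ht => ?_⟩
  have h1 := h1 s t (ht.trans_le (min_le_left _ _))
  obtain ⟨h2, h3⟩ := h2 s t (ht.trans_le (min_le_right _ _))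
  rw [← D.cbrtCurvature_pow, ← three_mul_sq_cbrtCurvature] at h3
  have hX := hM s t
  have hK := hC s
  have hk := D.cbrtCurvature_pos s
  simp only [smul_eq_mul, Real.norm_eq_abs] at h1
  set X := D.lazutkin (s + t) - D.lazutkin s
  set k := D.cbrtCurvature s
  set k' := deriv D.cbrtCurvature s
  set L := D.lazutkinLength
  set a := (D.chordInFrame s t).re
  set b := (D.chordInFrame s t).im
  set e₁ := X - t * (k ^ 2 / L) - t ^ 2 / 2 * (2 * k * k' / L) with he₁
  set e₃ := b - (k ^ 3 * t ^ 2 / 2 + 3 * k ^ 2 * k' * t ^ 3 / 6) with he₃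
  -- This identity explains the exponent `2/3`: both products expand to `(k² t² + k k' t³) / L`, so
  -- the terms of order two and three cancel and only remainders are left.
  have hid : X * a - 2 / (L * k) * b = e₁ * t + X * (a - t) - 2 / (L * k) * e₃ := by
    rw [he₁, he₃]; field_simp; ring
  rw [hid]
  have ht3 : |t| ^ 3 = |t| ^ 2 * |t| := by ring
  have g1 : |e₁ * t| ≤ ε' * |t| ^ 3 := by
    rw [abs_mul, ht3, ← mul_assoc]; gcongr
  have g2 : |X * (a - t)| ≤ M * ε' * |t| ^ 3 := by
    rw [abs_mul]
    calc _ ≤ (M * |t|) * (ε' * |t| ^ 2) := by gcongr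
      _ = _ := by ring
  have g3 : |2 / (L * k) * e₃| ≤ C * ε' * |t| ^ 3 := by
    rw [abs_mul]
    calc _ ≤ C * (ε' * |t| ^ 3) := by gcongr
      _ = _ := by ring
  calc _ ≤ |e₁ * t| + |X * (a - t)| + |2 / (L * k) * e₃| :=
        (abs_sub _ _).trans (by gcongr; exact abs_add_le _ _)
    _ ≤ ε' * (1 + M + C) * |t| ^ 3 := by linarith
    _ = ε * |t| ^ 3 := by rw [hε', div_mul_cancel₀ _ (by positivity)]

/-- Along a short billiard trajectory the steps in the Lazutkin coordinate are constant up to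
errors of higher than second order. -/
theorem lazutkin_second_difference : ∀ ε > 0, ∃ η > 0, ∀ a b c : ℝ, a < b → b < c →
    b - a < η → c - b < η → D.angleIn a b = D.angleOut b c →
    |(D.lazutkin c - D.lazutkin b) - (D.lazutkin b - D.lazutkin a)| ≤
      ε * ((D.lazutkin b - D.lazutkin a) ^ 2 + (D.lazutkin c - D.lazutkin b) ^ 2) := by
  intro ε hε
  obtain ⟨m, hm, hmx⟩ := D.exists_le_lazutkin_sub
  obtain ⟨η₁, hη₁, h1⟩ := D.chordInFrame_estimate 1 one_pos
  -- The factor `m ^ 2` converts squares of arc lengths into squares of Lazutkin steps; the `2` pays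
  -- for dividing by `r * cos φ ≥ |t| / 2`, which holds for `|t| < 1 / 2`.
  obtain ⟨η₂, hη₂, h2⟩ := D.lazutkin_estimate (ε * m ^ 2 / 2) (by positivity)
  refine ⟨min (min η₁ η₂) (1 / 2), by positivity, fun a b c hab hbc ha hc hφ => ?_⟩
  rw [angleIn_eq_arg hab, angleOut_eq_arg hbc] at hφ
  set φ := ((D.γ c - D.γ b) * (starRingEnd ℂ) (deriv D.γ b)).arg
  have hη : ∀ {t : ℝ}, |t| < min (min η₁ η₂) (1 / 2) → |t| < η₁ ∧ |t| < η₂ ∧ |t| < 1 / 2 :=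
    fun h => ⟨h.trans_le ((min_le_left _ _).trans (min_le_left _ _)),
      h.trans_le ((min_le_left _ _).trans (min_le_right _ _)), h.trans_le (min_le_right _ _)⟩
  set K := 2 / (D.lazutkinLength * D.cbrtCurvature b)
  -- Both chords at the middle point `b` make the same angle `φ` with the tangent. `σ` is the sign
  -- of `t`, for the chord forward to `c` or backward to `a`; either way the step is `K * tan φ` up
  -- to the error, with the same `K`.
  have key : ∀ t r σ : ℝ, |t| < min (min η₁ η₂) (1 / 2) → 0 < σ * t → (σ = 1 ∨ σ = -1) →
      (D.chordInFrame b t).re = σ * (r * Real.cos φ) → (D.chordInFrame b t).im = r * Real.sin φ →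
      |σ * (D.lazutkin (b + t) - D.lazutkin b) - K * (Real.sin φ / Real.cos φ)|
        ≤ ε * m ^ 2 * |t| ^ 2 := by
    intro t r σ ht hσt hσ hre him
    obtain ⟨ht1, ht2, ht3⟩ := hη ht
    have hσ2 : σ * σ = 1 := by rcases hσ with rfl | rfl <;> norm_num
    have hσa : |σ| = 1 := by rcases hσ with rfl | rfl <;> norm_num
    have habs : |t| = σ * t := by
      rw [← abs_of_pos hσt, abs_mul, hσa, one_mul]
    have g1 := (h1 b t ht1).1
    have g2 := h2 b t ht2
    rw [hre, him] at g2
    rw [hre] at g1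
    have ht0 : 0 < |t| := by rw [habs]; exact hσt
    have g3 : |t| / 2 ≤ r * Real.cos φ := by
      have g4 : |r * Real.cos φ - (|t|)| ≤ 1 * |t| ^ 2 := by
        have : r * Real.cos φ - |t| = σ * (σ * (r * Real.cos φ) - t) := by
          rw [habs]; linear_combination (-(r * Real.cos φ)) * hσ2
        rw [this, abs_mul, hσa, one_mul]; exact g1
      have g5 := (abs_le.1 g4).1
      nlinarith
    have hrc : 0 < r * Real.cos φ := by linarith
    have hcos : Real.cos φ ≠ 0 := right_ne_zero_of_mul hrc.ne'
    have hr : r ≠ 0 := left_ne_zero_of_mul hrc.ne'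
    have hid : σ * (D.lazutkin (b + t) - D.lazutkin b) - K * (Real.sin φ / Real.cos φ) =
        ((D.lazutkin (b + t) - D.lazutkin b) * (σ * (r * Real.cos φ)) - K * (r * Real.sin φ)) /
          (r * Real.cos φ) := by
      field_simp
    rw [hid, abs_div, abs_of_pos hrc, div_le_iff₀ hrc]
    refine g2.trans ?_
    calc ε * m ^ 2 / 2 * |t| ^ 3 = ε * m ^ 2 * |t| ^ 2 * (|t| / 2) := by ring
      _ ≤ _ := by gcongr
  have e2 := key (c - b) ‖D.γ c - D.γ b‖ 1 (by rwa [abs_of_pos (by linarith)]) (by linarith)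
    (Or.inl rfl)
    (by
      rw [chordInFrame, add_sub_cancel, one_mul]
      have := Complex.norm_mul_cos_arg ((D.γ c - D.γ b) * (starRingEnd ℂ) (deriv D.γ b))
      rwa [norm_mul, RCLike.norm_conj, D.unit_speed, mul_one, eq_comm] at this)
    (by
      rw [chordInFrame, add_sub_cancel]
      have := Complex.norm_mul_sin_arg ((D.γ c - D.γ b) * (starRingEnd ℂ) (deriv D.γ b))
      rwa [norm_mul, RCLike.norm_conj, D.unit_speed, mul_one, eq_comm] at this)
  -- In the frame at `b`, the backward chord is minus the complex conjugate of the number whose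
  -- argument is `angleIn a b`: the real part changes sign, the imaginary part does not.
  have e1 := key (a - b) ‖D.γ b - D.γ a‖ (-1)
    (by rwa [abs_of_neg (by linarith), neg_sub]) (by linarith) (Or.inr rfl)
    (by
      have := Complex.norm_mul_cos_arg ((starRingEnd ℂ) (D.γ b - D.γ a) * deriv D.γ b)
      rw [norm_mul, RCLike.norm_conj, D.unit_speed, mul_one, hφ] at this
      rw [this, chordInFrame, add_sub_cancel]
      simp only [map_sub, Complex.mul_re, Complex.sub_re, Complex.sub_im, Complex.conj_re,
        Complex.conj_im]
      ring)
    (by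
      have := Complex.norm_mul_sin_arg ((starRingEnd ℂ) (D.γ b - D.γ a) * deriv D.γ b)
      rw [norm_mul, RCLike.norm_conj, D.unit_speed, mul_one, hφ] at this
      rw [this, chordInFrame, add_sub_cancel]
      simp only [map_sub, Complex.mul_im, Complex.sub_re, Complex.sub_im, Complex.conj_re,
        Complex.conj_im]
      ring)
  rw [add_sub_cancel] at e1 e2
  have f1 := hmx a b hab.le
  have f2 := hmx b c hbc.le
  have f1' : (m * (b - a)) ^ 2 ≤ (D.lazutkin b - D.lazutkin a) ^ 2 := by
    have : 0 ≤ m * (b - a) := mul_nonneg hm.le (by linarith)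
    gcongr
  have f2' : (m * (c - b)) ^ 2 ≤ (D.lazutkin c - D.lazutkin b) ^ 2 := by
    have : 0 ≤ m * (c - b) := mul_nonneg hm.le (by linarith)
    gcongr
  have f3 := mul_le_mul_of_nonneg_left (add_le_add f1' f2') hε.le
  rw [sq_abs] at e1 e2
  have e1' := abs_le.1 e1
  have e2' := abs_le.1 e2
  rw [abs_le]
  constructor <;> nlinarith [e1'.1, e1'.2, e2'.1, e2'.2]

end StrictlyConvexTable

/-! ### From an integral of motion to a family of invariant curves with an invariant density. -/

namespace StrictlyConvexTable

/-- An integral of motion near the boundary that vanishes on the boundary and increases with the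
angle, continued to all angles. It is an integral of motion for angles below `δ` only. -/
structure NormalizedIntegral (D : StrictlyConvexTable) where
  δ : ℝ
  δ_pos : 0 < δ
  F : ℝ → ℝ → ℝ
  continuous_F : Continuous fun p : ℝ × ℝ => F p.1 p.2
  strictMono_F : ∀ s, StrictMono (F s)
  surjective_F : ∀ s, Function.Surjective (F s)
  F_zero : ∀ s, F s 0 = 0
  F_add_length : ∀ s φ, F (s + D.length) φ = F s φ
  differentiableAt_F : ∀ s, ∀ φ ∈ Ioo 0 δ,
    DifferentiableAt ℝ (fun p : ℝ × ℝ => F p.1 p.2) (s, φ)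
  deriv_F_pos : ∀ s, ∀ φ ∈ Ioo 0 δ, 0 < deriv (F s) φ
  continuousOn_deriv_F : ContinuousOn (fun p : ℝ × ℝ => deriv (F p.1) p.2) (univ ×ˢ Ioo 0 δ)
  F_angleIn : ∀ s, ∀ t ∈ Ioo s (s + D.length), D.angleOut s t < δ → D.angleIn s t < δ →
    F t (D.angleIn s t) = F s (D.angleOut s t)

variable {D : StrictlyConvexTable}

theorem isOpen_strip (δ : ℝ) : IsOpen {x : ℝ × ℝ | 0 < x.2 ∧ x.2 < δ} :=
  (isOpen_lt continuous_const continuous_snd).inter (isOpen_lt continuous_snd continuous_const)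

theorem hasDerivAt_partial_snd {F : ℝ × ℝ → ℝ} {s φ : ℝ} (h : DifferentiableAt ℝ F (s, φ)) :
    HasDerivAt (fun ψ => F (s, ψ)) (fderiv ℝ F (s, φ) (0, 1)) φ := by
  have h1 : HasDerivAt (fun ψ : ℝ => (s, ψ)) ((0, 1) : ℝ × ℝ) φ :=
    (hasDerivAt_const φ s).prodMk (hasDerivAt_id φ)
  exact h.hasFDerivAt.comp_hasDerivAt φ h1

theorem hasDerivAt_partial_fst {F : ℝ × ℝ → ℝ} {s φ : ℝ} (h : DifferentiableAt ℝ F (s, φ)) :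
    HasDerivAt (fun t => F (t, φ)) (fderiv ℝ F (s, φ) (1, 0)) s := by
  have h1 : HasDerivAt (fun t : ℝ => (t, φ)) ((1, 0) : ℝ × ℝ) s :=
    (hasDerivAt_id s).prodMk (hasDerivAt_const s φ)
  exact h.hasFDerivAt.comp_hasDerivAt s h1

/-- The derivative in `φ` of a `C¹` function on a strip, if it does not vanish, has a sign. -/
theorem exists_sign_of_deriv_ne_zero {F : ℝ × ℝ → ℝ} {δ : ℝ}
    (hF : ContinuousOn (fun x : ℝ × ℝ => deriv (fun ψ => F (x.1, ψ)) x.2)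
      {x : ℝ × ℝ | 0 < x.2 ∧ x.2 < δ})
    (h : ∀ s φ : ℝ, 0 < φ → φ < δ → deriv (fun ψ : ℝ => F (s, ψ)) φ ≠ 0) :
    ∃ σ : ℝ, ∀ s φ : ℝ, 0 < φ → φ < δ → 0 < σ * deriv (fun ψ : ℝ => F (s, ψ)) φ := by
  have hconv : Convex ℝ {x : ℝ × ℝ | 0 < x.2 ∧ x.2 < δ} := by
    have : {x : ℝ × ℝ | 0 < x.2 ∧ x.2 < δ} = univ ×ˢ Ioo 0 δ := by ext; simp
    rw [this]; exact convex_univ.prod (convex_Ioo _ _)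
  have hpre := (hconv.isPreconnected.image _ hF).ordConnected
  by_cases hpos : ∀ s φ : ℝ, 0 < φ → φ < δ → 0 < deriv (fun ψ : ℝ => F (s, ψ)) φ
  · exact ⟨1, by simpa using hpos⟩
  · push Not at hpos
    obtain ⟨s, φ, h1, h2, h3⟩ := hpos
    refine ⟨-1, fun s' φ' h1' h2' => ?_⟩
    by_contra hcon
    have h4 : 0 ≤ deriv (fun ψ : ℝ => F (s', ψ)) φ' := by linarith
    obtain ⟨x, hx, hx0⟩ := hpre.out ⟨(s, φ), ⟨h1, h2⟩, rfl⟩ ⟨(s', φ'), ⟨h1', h2'⟩, rfl⟩ ⟨h3, h4⟩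
    exact h x.1 x.2 hx.1 hx.2 hx0

/-- Subtract the boundary value of `F` and correct the sign of `∂F/∂φ`, which is constant because
the strip is connected. -/
theorem IntegrableNearBoundary.nonempty_normalizedIntegral (h : D.IntegrableNearBoundary) :
    Nonempty (NormalizedIntegral D) := by
  obtain ⟨δ, F, hδ, hδπ, hper, hcont, hC1, hne, hzero, hinv⟩ := h
  have hdiff : ∀ s φ : ℝ, 0 < φ → φ < δ → DifferentiableAt ℝ F (s, φ) := fun s φ h1 h2 =>
    (hC1.contDiffAt ((isOpen_strip δ).mem_nhds ⟨h1, h2⟩)).differentiableAt (by norm_num)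
  have hdc : ContinuousOn (fun x : ℝ × ℝ => deriv (fun ψ => F (x.1, ψ)) x.2)
      {x : ℝ × ℝ | 0 < x.2 ∧ x.2 < δ} := by
    have h1 : ContinuousOn (fun x : ℝ × ℝ => fderiv ℝ F x (0, 1)) {x : ℝ × ℝ | 0 < x.2 ∧ x.2 < δ} :=
      (hC1.continuousOn_fderiv_of_isOpen (isOpen_strip δ) le_rfl).clm_apply continuousOn_const
    exact h1.congr fun x hx => (hasDerivAt_partial_snd (hdiff x.1 x.2 hx.1 hx.2)).deriv
  obtain ⟨σ, hσ⟩ := exists_sign_of_deriv_ne_zero hdc hne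
  set G : ℝ → ℝ → ℝ := fun s φ => σ * (F (s, φ) - F (0, 0)) with hG
  -- The extension with slope one needs a closed interval, while `F` is controlled on `[0, δ)` only.
  have hη : (0 : ℝ) ≤ δ / 2 := by linarith
  have hGc : ContinuousOn (fun p : ℝ × ℝ => G p.1 p.2) (univ ×ˢ Icc 0 (δ / 2)) := by
    have h1 : ContinuousOn F (univ ×ˢ Icc 0 (δ / 2)) :=
      hcont.mono fun x hx => ⟨hx.2.1, hx.2.2.trans_lt (by linarith)⟩
    exact (h1.sub continuousOn_const).const_mul σ
  have hGd : ∀ s φ : ℝ, 0 < φ → φ < δ → HasDerivAt (G s) (σ * deriv (fun ψ => F (s, ψ)) φ) φ := by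
    intro s φ h1 h2
    have := (hasDerivAt_partial_snd (hdiff s φ h1 h2))
    have h3 := (this.sub_const (F (0, 0))).const_mul σ
    rw [this.deriv]; exact h3
  have hGm : ∀ s, StrictMonoOn (G s) (Icc 0 (δ / 2)) := by
    intro s
    refine strictMonoOn_of_deriv_pos (convex_Icc _ _) ?_ fun φ hφ => ?_
    · exact hGc.comp (f := fun φ : ℝ => (s, φ)) (by fun_prop) fun φ hφ => ⟨mem_univ _, hφ⟩
    · rw [interior_Icc] at hφ
      rw [(hGd s φ hφ.1 (by linarith [hφ.2])).deriv]
      exact hσ s φ hφ.1 (by linarith [hφ.2])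
  have hloc : ∀ s, ∀ φ ∈ Ioo 0 (δ / 2), (fun p : ℝ × ℝ => extendWithSlopeOne (δ / 2) G p.1 p.2)
      =ᶠ[𝓝 (s, φ)] fun p => G p.1 p.2 := by
    intro s φ hφ
    filter_upwards [(isOpen_strip (δ / 2)).mem_nhds (show (s, φ) ∈ _ from hφ)] with p hp
    exact extendWithSlopeOne_of_mem G p.1 ⟨hp.1.le, hp.2.le⟩
  have hderiv : ∀ s, ∀ φ ∈ Ioo 0 (δ / 2), deriv (extendWithSlopeOne (δ / 2) G s) φ =
      σ * deriv (fun ψ => F (s, ψ)) φ := by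
    intro s φ hφ
    rw [← (hGd s φ hφ.1 (by linarith [hφ.2])).deriv]
    refine Filter.EventuallyEq.deriv_eq ?_
    filter_upwards [isOpen_Ioo.mem_nhds hφ] with ψ hψ
    exact extendWithSlopeOne_of_mem G s ⟨hψ.1.le, hψ.2.le⟩
  refine ⟨{ δ := δ / 2, δ_pos := by linarith, F := extendWithSlopeOne (δ / 2) G,
            continuous_F := continuous_extendWithSlopeOne hη hGc,
            strictMono_F := fun s => strictMono_extendWithSlopeOne hη (hGm s),
            surjective_F := fun s => surjective_extendWithSlopeOne hη s hGc,
            F_zero := fun s => ?_, F_add_length := fun s φ => ?_,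
            differentiableAt_F := fun s φ hφ => ?_,
            deriv_F_pos := fun s φ hφ => ?_, continuousOn_deriv_F := ?_,
            F_angleIn := fun s t ht h1 h2 => ?_ }⟩
  · rw [extendWithSlopeOne_of_mem G s ⟨le_rfl, hη⟩]
    simp [hG, hzero s]
  · simp only [extendWithSlopeOne, hG, hper]
  · refine DifferentiableAt.congr_of_eventuallyEq ?_ (hloc s φ hφ)
    exact ((hdiff s φ hφ.1 (by linarith [hφ.2])).sub_const _).const_mul σ
  · rw [hderiv s φ hφ]; exact hσ s φ hφ.1 (by linarith [hφ.2])
  · have h1 : ContinuousOn (fun x : ℝ × ℝ => σ * deriv (fun ψ => F (x.1, ψ)) x.2)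
        (univ ×ˢ Ioo 0 (δ / 2)) :=
      (hdc.mono fun x hx => ⟨hx.2.1, hx.2.2.trans (by linarith)⟩).const_mul σ
    exact h1.congr fun x hx => hderiv x.1 x.2 hx.2
  · have ho := angleOut_mem ht
    have hi := angleIn_mem ht
    rw [extendWithSlopeOne_of_mem G s ⟨ho.1.le, h1.le⟩,
      extendWithSlopeOne_of_mem G t ⟨hi.1.le, h2.le⟩]
    have := hinv s t (D.phase s (D.angleOut s t)).2 (D.phase t (D.angleIn s t)).2
      (by rw [phase_snd ⟨ho.1.le, ho.2.le⟩]; linarith)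
      (by rw [phase_snd ⟨hi.1.le, hi.2.le⟩]; linarith) (billiardMap_phase ht)
    rw [phase_snd ⟨ho.1.le, ho.2.le⟩, phase_snd ⟨hi.1.le, hi.2.le⟩] at this
    simp only [hG, this]

/-- The foliation of a neighbourhood of the boundary by invariant curves: `angle s c` is the angle
over `s` of the curve on which the integral of motion `F` has the value `c`, and `next s c` is the
arc-length coordinate of the image of that point. -/
structure LevelFamily (D : StrictlyConvexTable) where
  c₀ : ℝ
  c₀_pos : 0 < c₀
  F : ℝ → ℝ → ℝ
  continuous_F : Continuous fun p : ℝ × ℝ => F p.1 p.2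
  strictMono_F : ∀ s, StrictMono (F s)
  F_zero : ∀ s, F s 0 = 0
  F_add_length : ∀ s φ, F (s + D.length) φ = F s φ
  angle : ℝ → ℝ → ℝ
  continuous_angle : Continuous fun p : ℝ × ℝ => angle p.1 p.2
  F_angle : ∀ s c, F s (angle s c) = c
  next : ℝ → ℝ → ℝ
  continuous_next : Continuous fun p : ℝ × ℝ => next p.1 p.2
  next_zero : ∀ s, next s 0 = s
  next_add_length : ∀ s c, next (s + D.length) c = next s c + D.length
  strictMono_next : ∀ s, StrictMono (next s)
  next_lt : ∀ s c, c ≤ c₀ → next s c < s + D.length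
  angleOut_next : ∀ s, ∀ c ∈ Icc 0 c₀, D.angleOut s (next s c) = angle s c
  angleIn_next : ∀ s, ∀ c ∈ Icc 0 c₀, D.angleIn s (next s c) = angle (next s c) c
  weight : ℝ → ℝ → ℝ
  continuousOn_weight : ContinuousOn (fun p : ℝ × ℝ => weight p.1 p.2) (univ ×ˢ Ioo 0 c₀)
  weight_pos : ∀ s, ∀ c ∈ Ioo 0 c₀, 0 < weight s c
  weight_add_length : ∀ s c, weight (s + D.length) c = weight s c
  hasDerivAt_next : ∀ s, ∀ c ∈ Ioo 0 c₀,
    HasDerivAt (fun s => next s c) (weight s c / weight (next s c) c) s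

/-- Area preservation: a level curve of the integral of motion carries the invariant density
`sin φ / (∂F/∂φ)`. -/
theorem NormalizedIntegral.hasDerivAt_level (N : NormalizedIntegral D) {s c : ℝ} {f : ℝ → ℝ}
    (hf : ContinuousAt f s) (hc : ∀ᶠ u in 𝓝 s, N.F u (D.angleOut u (f u)) = c)
    (ht : f s ∈ Ioo s (s + D.length)) (ho : D.angleOut s (f s) < N.δ)
    (hi : D.angleIn s (f s) < N.δ) :
    HasDerivAt f ((Real.sin (D.angleOut s (f s)) / deriv (N.F s) (D.angleOut s (f s))) /
      (Real.sin (D.angleIn s (f s)) / deriv (N.F (f s)) (D.angleIn s (f s)))) s := by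
  set t := f s with ht_def
  have ho' := angleOut_mem ht
  have hi' := angleIn_mem ht
  -- The integral as a function of the two endpoints of the chord; the graph of `f` is a level curve
  -- of `A`.
  set A : ℝ × ℝ → ℝ := fun p => N.F p.1 (D.angleOut p.1 p.2) with hA
  have hAd : DifferentiableAt ℝ A (s, t) := by
    have h1 : DifferentiableAt ℝ (fun p : ℝ × ℝ => (p.1, D.angleOut p.1 p.2)) (s, t) :=
      differentiableAt_fst.prodMk (differentiableAt_angleOut ht)
    exact DifferentiableAt.comp (f := fun p : ℝ × ℝ => (p.1, D.angleOut p.1 p.2)) (s, t)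
      (N.differentiableAt_F s (D.angleOut s t) ⟨ho'.1, ho⟩) h1
  have hr : 0 < ‖D.γ t - D.γ s‖ := norm_pos_iff.2 (chord_ne_zero ht)
  have hFd : ∀ s φ, φ ∈ Ioo 0 N.δ → HasDerivAt (N.F s) (deriv (N.F s) φ) φ := fun s φ hφ => by
    have := hasDerivAt_partial_snd (N.differentiableAt_F s φ hφ)
    exact this.differentiableAt.hasDerivAt
  have hp2 : fderiv ℝ A (s, t) (0, 1) =
      deriv (N.F s) (D.angleOut s t) * (Real.sin (D.angleIn s t) / ‖D.γ t - D.γ s‖) := by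
    refine (hasDerivAt_partial_snd hAd).unique ?_
    exact (hFd s _ ⟨ho'.1, ho⟩).comp t (hasDerivAt_angleOut ht)
  -- By invariance `A` is also `N.F t (D.angleIn s t)` near this point. In this form `s` enters
  -- through the angle alone, so no `s`-derivative of `F` is needed. The chord length cancels in the
  -- quotient.
  have hp1 : fderiv ℝ A (s, t) (1, 0) =
      deriv (N.F t) (D.angleIn s t) * -(Real.sin (D.angleOut s t) / ‖D.γ t - D.γ s‖) := by
    refine (hasDerivAt_partial_fst hAd).unique ?_
    have h1 := (hFd t _ ⟨hi'.1, hi⟩).comp s (hasDerivAt_angleIn ht)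
    refine h1.congr_of_eventuallyEq ?_
    have e1 : ∀ᶠ u in 𝓝 s, D.angleOut u t < N.δ :=
      ((continuousAt_angleOut (p := (s, t)) (Ioo_subset_Ico_self ht)).comp (f := fun u : ℝ => (u, t))
        (by fun_prop)).eventually (gt_mem_nhds ho)
    have e2 : ∀ᶠ u in 𝓝 s, D.angleIn u t < N.δ :=
      ((continuousAt_angleIn (p := (s, t)) (Ioo_subset_Ico_self ht)).comp (f := fun u : ℝ => (u, t))
        (by fun_prop)).eventually (gt_mem_nhds hi)
    have e3 : ∀ᶠ u in 𝓝 s, t ∈ Ioo u (u + D.length) := by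
      filter_upwards [gt_mem_nhds ht.1, lt_mem_nhds (show t - D.length < s by linarith [ht.2])]
        with u h1 h2
      exact ⟨h1, by linarith⟩
    filter_upwards [e1, e2, e3] with u h1 h2 h3
    exact (N.F_angleIn u t h3 h1 h2).symm
  have hs1 := Real.sin_pos_of_mem_Ioo ho'
  have hs2 := Real.sin_pos_of_mem_Ioo hi'
  have hd1 := N.deriv_F_pos s _ ⟨ho'.1, ho⟩
  have hd2 := N.deriv_F_pos t _ ⟨hi'.1, hi⟩
  have hne : fderiv ℝ A (s, t) (0, 1) ≠ 0 := by rw [hp2]; positivity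
  refine (HasFDerivAt.hasDerivAt_implicit hAd.hasFDerivAt hne hf hc).congr_deriv ?_
  rw [hp1, hp2]
  field_simp

/-- The next foot point on the level `c` is `s + h`, where `h` solves `F s (angleOut s (s + h)) =
c`; the left side is increasing in `h`, so the continuous inverse family provides `h`. -/
theorem NormalizedIntegral.nonempty_levelFamily (N : NormalizedIntegral D) :
    Nonempty (LevelFamily D) := by
  have hl := D.length_pos
  obtain ⟨angle, hangle, hFangle⟩ := exists_continuous_inverse_family N.continuous_F N.strictMono_F
    N.surjective_F
  have hmaps : ∀ p ∈ (univ : Set ℝ) ×ˢ Icc (0 : ℝ) (D.length / 2),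
      p.1 + p.2 ∈ Ico p.1 (p.1 + D.length) := fun p hp =>
    ⟨by linarith [hp.2.1], by linarith [hp.2.2]⟩
  have hoc : ContinuousOn (fun p : ℝ × ℝ => D.angleOut p.1 (p.1 + p.2))
      (univ ×ˢ Icc 0 (D.length / 2)) := fun p hp =>
    ((continuousAt_angleOut (p := (p.1, p.1 + p.2)) (hmaps p hp)).comp
      (f := fun p : ℝ × ℝ => (p.1, p.1 + p.2)) (by fun_prop)).continuousWithinAt
  have hic : ContinuousOn (fun p : ℝ × ℝ => D.angleIn p.1 (p.1 + p.2))
      (univ ×ˢ Icc 0 (D.length / 2)) := fun p hp =>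
    ((continuousAt_angleIn (p := (p.1, p.1 + p.2)) (hmaps p hp)).comp
      (f := fun p : ℝ × ℝ => (p.1, p.1 + p.2)) (by fun_prop)).continuousWithinAt
  obtain ⟨η₁, hη₁, hη₁l, h1⟩ := exists_uniform_small (G := fun s h => D.angleOut s (s + h)) hl
    (half_pos hl) hoc (fun s h => by
      rw [show s + D.length + h = s + h + D.length by ring, angleOut_add_length])
    (fun s => by rw [add_zero, angleOut_self]) N.δ_pos
  obtain ⟨η₂, hη₂, hη₂l, h2⟩ := exists_uniform_small (G := fun s h => D.angleIn s (s + h)) hl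
    (half_pos hl) hic (fun s h => by
      rw [show s + D.length + h = s + h + D.length by ring, angleIn_add_length])
    (fun s => by rw [add_zero, angleIn_self]) N.δ_pos
  -- For chords of arc length at most `η` both angles are below `N.δ`, so `F` is invariant along
  -- them.
  set η := min η₁ η₂ with hη_def
  have hη : 0 < η := lt_min hη₁ hη₂
  have hηl : η ≤ D.length / 2 := (min_le_left _ _).trans hη₁l
  have ho : ∀ s, ∀ h ∈ Icc 0 η, D.angleOut s (s + h) < N.δ := fun s h hh =>
    (le_abs_self _).trans_lt (h1 s h ⟨hh.1, hh.2.trans (min_le_left _ _)⟩)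
  have hi : ∀ s, ∀ h ∈ Icc 0 η, D.angleIn s (s + h) < N.δ := fun s h hh =>
    (le_abs_self _).trans_lt (h2 s h ⟨hh.1, hh.2.trans (min_le_right _ _)⟩)
  set B : ℝ → ℝ → ℝ := fun s h => N.F s (D.angleOut s (s + h)) with hB
  have hBc : ContinuousOn (fun p : ℝ × ℝ => B p.1 p.2) (univ ×ˢ Icc 0 η) :=
    N.continuous_F.comp_continuousOn (continuousOn_fst.prodMk
      (hoc.mono (prod_mono subset_rfl (Icc_subset_Icc_right hηl))))
  have hBm : ∀ s, StrictMonoOn (B s) (Icc 0 η) := fun s a ha b hb hab =>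
    N.strictMono_F s (strictMonoOn_angleOut s ⟨by linarith [ha.1], by linarith [ha.2]⟩
      ⟨by linarith [hb.1], by linarith [hb.2]⟩ (by linarith))
  have hBp : ∀ s h, B (s + D.length) h = B s h := fun s h => by
    simp only [hB]
    rw [show s + D.length + h = s + h + D.length by ring, angleOut_add_length, N.F_add_length]
  have hB0 : ∀ s, B s 0 = 0 := fun s => by simp [hB, angleOut_self, N.F_zero]
  set E := extendWithSlopeOne η B with hE
  have hEm : ∀ s, StrictMono (E s) := fun s => strictMono_extendWithSlopeOne hη.le (hBm s)
  obtain ⟨g, hg, hEg⟩ := exists_continuous_inverse_family (continuous_extendWithSlopeOne hη.le hBc)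
    hEm (fun s => surjective_extendWithSlopeOne hη.le s hBc)
  replace hEg : ∀ s c, E s (g s c) = c := hEg
  have hEp : ∀ s, E (s + D.length) = E s := fun s => by
    ext h; simp only [hE, extendWithSlopeOne, hBp]
  have hE0 : ∀ s, E s 0 = 0 := fun s => by
    rw [hE, extendWithSlopeOne_of_mem B s ⟨le_rfl, hη.le⟩, hB0]
  have hEη : ∀ s, E s η = B s η := fun s => extendWithSlopeOne_of_mem B s ⟨hη.le, le_rfl⟩
  have hgm : ∀ s, StrictMono (g s) := fun s a b hab => (hEm s).lt_iff_lt.1 (by rwa [hEg, hEg])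
  have hg0 : ∀ s, g s 0 = 0 := fun s => (hEm s).injective (by rw [hEg, hE0])
  have hgp : ∀ s c, g (s + D.length) c = g s c := fun s c =>
    (hEm s).injective (by rw [hEg, ← hEp s, hEg])
  -- Levels up to `c₀`, the least value of the integral on chords of arc length `η`, are reached by
  -- chords no longer than that.
  obtain ⟨c₀, hc₀, hc₀η⟩ := exists_pos_le_of_periodic (f := fun s => B s η) hl
    (hBc.comp_continuous (f := fun s : ℝ => (s, η)) (by fun_prop)
      fun s => ⟨mem_univ _, hη.le, le_rfl⟩)
    (fun s => hBp s η) (fun s => by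
      have := hBm s ⟨le_rfl, hη.le⟩ ⟨hη.le, le_rfl⟩ hη
      rwa [hB0] at this)
  have hgη : ∀ s c, c ≤ c₀ → g s c ≤ η := fun s c hc => (hEm s).le_iff_le.1 (by
    rw [hEg, hEη]; exact hc.trans (hc₀η s))
  have hgmem : ∀ s, ∀ c ∈ Icc 0 c₀, g s c ∈ Icc 0 η := fun s c hc =>
    ⟨by rw [← hg0 s]; exact (hgm s).monotone hc.1, hgη s c hc.2⟩
  have hBg : ∀ s, ∀ c ∈ Icc 0 c₀, B s (g s c) = c := fun s c hc => by
    rw [← extendWithSlopeOne_of_mem B s (hgmem s c hc)]; exact hEg s c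
  have hgpos : ∀ s c, 0 < c → 0 < g s c := fun s c hc => by rw [← hg0 s]; exact hgm s hc
  have hout : ∀ s, ∀ c ∈ Icc 0 c₀, D.angleOut s (s + g s c) = angle s c := fun s c hc =>
    (N.strictMono_F s).injective (by rw [hFangle]; exact hBg s c hc)
  have hIoo : ∀ s, ∀ c, 0 < c → c ≤ c₀ → s + g s c ∈ Ioo s (s + D.length) := fun s c h0 h1 =>
    ⟨by linarith [hgpos s c h0], by linarith [hgη s c h1]⟩
  have hin : ∀ s, ∀ c ∈ Icc 0 c₀, D.angleIn s (s + g s c) = angle (s + g s c) c := fun s c hc => by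
    refine (N.strictMono_F (s + g s c)).injective ?_
    rw [hFangle]
    rcases hc.1.eq_or_lt with rfl | hpos
    · rw [hg0, add_zero, angleIn_self, N.F_zero]
    · rw [N.F_angleIn s _ (hIoo s c hpos hc.2) (ho s _ (hgmem s c hc)) (hi s _ (hgmem s c hc))]
      exact hBg s c hc
  have hangle_mem : ∀ s, ∀ c ∈ Ioo 0 c₀, angle s c ∈ Ioo 0 Real.pi ∧ angle s c < N.δ :=
    fun s c hc => by
      have hc' := Ioo_subset_Icc_self hc
      rw [← hout s c hc']
      exact ⟨angleOut_mem (hIoo s c hc.1 hc.2.le), ho s _ (hgmem s c hc')⟩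
  refine ⟨{ c₀ := c₀, c₀_pos := hc₀, F := N.F, continuous_F := N.continuous_F,
            strictMono_F := N.strictMono_F, F_zero := N.F_zero, F_add_length := N.F_add_length,
            angle := angle, continuous_angle := hangle, F_angle := hFangle,
            next := fun s c => s + g s c, continuous_next := continuous_fst.add hg,
            next_zero := fun s => by simp [hg0],
            next_add_length := fun s c => by rw [hgp]; ring,
            strictMono_next := fun s => (hgm s).const_add s,
            next_lt := fun s c hc => by linarith [hgη s c hc],
            angleOut_next := hout, angleIn_next := hin,
            weight := fun s c => Real.sin (angle s c) / deriv (N.F s) (angle s c),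
            continuousOn_weight := ?_, weight_pos := fun s c hc => ?_,
            weight_add_length := fun s c => ?_, hasDerivAt_next := fun s c hc => ?_ }⟩
  · refine ContinuousOn.div (Real.continuous_sin.comp hangle).continuousOn ?_ ?_
    · exact N.continuousOn_deriv_F.comp (f := fun p : ℝ × ℝ => (p.1, angle p.1 p.2))
        (continuous_fst.prodMk hangle).continuousOn fun p hp =>
          ⟨mem_univ _, (hangle_mem p.1 p.2 hp.2).1.1, (hangle_mem p.1 p.2 hp.2).2⟩
    · exact fun p hp => (N.deriv_F_pos _ _
        ⟨(hangle_mem p.1 p.2 hp.2).1.1, (hangle_mem p.1 p.2 hp.2).2⟩).ne'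
  · have := hangle_mem s c hc
    exact div_pos (Real.sin_pos_of_mem_Ioo this.1) (N.deriv_F_pos _ _ ⟨this.1.1, this.2⟩)
  · have hF : N.F (s + D.length) = N.F s := funext fun φ => N.F_add_length s φ
    have : angle (s + D.length) c = angle s c := (N.strictMono_F s).injective (by
      rw [hFangle, ← hF, hFangle])
    rw [this, hF]
  · have hc' := Ioo_subset_Icc_self hc
    have hgs : Continuous fun u => u + g u c :=
      continuous_id.add (hg.comp (continuous_id.prodMk continuous_const))
    have := N.hasDerivAt_level (f := fun u => u + g u c) (s := s) (c := c) hgs.continuousAt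
      (Eventually.of_forall fun u => hBg u c hc') (hIoo s c hc.1 hc.2.le)
      (ho s _ (hgmem s c hc')) (hi s _ (hgmem s c hc'))
    rw [hout s c hc', hin s c hc'] at this
    exact this

end StrictlyConvexTable

/-! ### Translation coordinates on the level curves and their limit at the boundary. -/

namespace StrictlyConvexTable

variable {D : StrictlyConvexTable}

namespace LevelFamily

variable (L : LevelFamily D)

/-- The invariant measure of the arc from `0` to `s` on a level curve. -/
noncomputable def mass (s c : ℝ) : ℝ := ∫ t in (0 : ℝ)..s, L.weight t c

open Classical in
/-- The coordinate that conjugates the billiard map on a level curve to a translation. On the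
boundary it is the Lazutkin coordinate. -/
noncomputable def theta (s c : ℝ) : ℝ :=
  if 0 < c then L.mass s c / L.mass D.length c else D.lazutkin s

/-- The rotation number of the billiard map on a level curve. -/
noncomputable def rho (c : ℝ) : ℝ := L.theta (L.next 0 c) c

variable {L} {c : ℝ}

theorem continuous_weight (hc : c ∈ Ioo 0 L.c₀) : Continuous fun s => L.weight s c :=
  L.continuousOn_weight.comp_continuous (f := fun s : ℝ => (s, c)) (by fun_prop)
    fun _ => ⟨mem_univ _, hc⟩

theorem hasDerivAt_mass (hc : c ∈ Ioo 0 L.c₀) (s : ℝ) :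
    HasDerivAt (fun s => L.mass s c) (L.weight s c) s :=
  ((continuous_weight hc).integral_hasStrictDerivAt 0 s).hasDerivAt

theorem mass_length_pos (hc : c ∈ Ioo 0 L.c₀) : 0 < L.mass D.length c :=
  intervalIntegral.intervalIntegral_pos_of_pos ((continuous_weight hc).intervalIntegrable _ _)
    (fun s => L.weight_pos s c hc) D.length_pos

theorem mass_add_length (hc : c ∈ Ioo 0 L.c₀) (s : ℝ) :
    L.mass (s + D.length) c = L.mass s c + L.mass D.length c := by
  have hw := continuous_weight hc
  have h1 := intervalIntegral.integral_add_adjacent_intervals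
    (hw.intervalIntegrable (μ := MeasureTheory.volume) 0 s)
    (hw.intervalIntegrable s (s + D.length))
  have hp : Function.Periodic (fun s => L.weight s c) D.length := fun s => L.weight_add_length s c
  have h2 := hp.intervalIntegral_add_eq s 0
  rw [zero_add] at h2
  rw [mass, ← h1, h2, mass, mass]

theorem theta_of_pos (hc : 0 < c) (s : ℝ) : L.theta s c = L.mass s c / L.mass D.length c :=
  if_pos hc

theorem theta_zero_right (s : ℝ) : L.theta s 0 = D.lazutkin s := if_neg (lt_irrefl _)

theorem theta_zero_left : L.theta 0 c = 0 := by
  unfold theta mass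
  split_ifs
  · simp
  · exact D.lazutkin_zero

theorem theta_add_length (hc : c ∈ Ico 0 L.c₀) (s : ℝ) :
    L.theta (s + D.length) c = L.theta s c + 1 := by
  rcases hc.1.eq_or_lt with rfl | h
  · rw [theta_zero_right, theta_zero_right, D.lazutkin_add_length]
  · have hc' : c ∈ Ioo 0 L.c₀ := ⟨h, hc.2⟩
    rw [theta_of_pos h, theta_of_pos h, mass_add_length hc', add_div,
      div_self (mass_length_pos hc').ne']

theorem theta_length (hc : c ∈ Ico 0 L.c₀) : L.theta D.length c = 1 := by
  have := theta_add_length hc 0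
  rwa [zero_add, theta_zero_left, zero_add] at this

theorem strictMono_theta (hc : c ∈ Ico 0 L.c₀) : StrictMono fun s => L.theta s c := by
  rcases hc.1.eq_or_lt with rfl | h
  · simp only [theta_zero_right]; exact D.strictMono_lazutkin
  · have hc' : c ∈ Ioo 0 L.c₀ := ⟨h, hc.2⟩
    simp only [theta_of_pos h]
    refine strictMono_of_deriv_pos fun s => ?_
    rw [((hasDerivAt_mass hc' s).div_const _).deriv]
    exact div_pos (L.weight_pos s c hc') (mass_length_pos hc')

theorem continuous_theta_left (hc : c ∈ Ico 0 L.c₀) : Continuous fun s => L.theta s c := by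
  rcases hc.1.eq_or_lt with rfl | h
  · simp only [theta_zero_right]; exact D.continuous_lazutkin
  · simp only [theta_of_pos h]
    exact continuous_iff_continuousAt.2 fun s =>
      ((hasDerivAt_mass ⟨h, hc.2⟩ s).div_const _).continuousAt

/-- By `hasDerivAt_next` the density is invariant, so the mass of the arc from `s` to its image does
not depend on `s`. At `c = 0` the map is the identity. -/
theorem theta_next (hc : c ∈ Ico 0 L.c₀) (s : ℝ) :
    L.theta (L.next s c) c = L.theta s c + L.rho c := by
  rcases hc.1.eq_or_lt with rfl | h
  · rw [rho, L.next_zero, L.next_zero, theta_zero_left, add_zero]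
  · have hc' : c ∈ Ioo 0 L.c₀ := ⟨h, hc.2⟩
    have hd : ∀ s, HasDerivAt (fun s => L.mass (L.next s c) c - L.mass s c) 0 s := by
      intro s
      have h1 := ((hasDerivAt_mass hc' (L.next s c)).comp s (L.hasDerivAt_next s c hc')).sub
        (hasDerivAt_mass hc' s)
      rw [mul_div_cancel₀ _ (L.weight_pos _ c hc').ne', sub_self] at h1
      exact h1
    have h2 := is_const_of_deriv_eq_zero (fun s => (hd s).differentiableAt)
      (fun s => (hd s).deriv) s 0
    rw [rho, theta_of_pos h, theta_of_pos h, theta_of_pos h, ← add_div]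
    congr 1
    have h3 : L.mass 0 c = 0 := by simp [mass]
    rw [h3] at h2
    linarith

theorem rho_zero : L.rho 0 = 0 := by rw [rho, L.next_zero, theta_zero_left]

/-- The twist property: `next s c` increases strictly with `c`, and `translation_lt_of_lt` passes
this on to rotation numbers. -/
theorem strictMonoOn_rho : StrictMonoOn L.rho (Ico 0 L.c₀) := by
  intro c hc c' hc' hcc
  have hn : ∀ c, Continuous fun s => L.next s c := fun c =>
    L.continuous_next.comp (continuous_id.prodMk continuous_const)
  exact translation_lt_of_lt D.length_pos (hn c) (hn c') (continuous_theta_left hc)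
    (continuous_theta_left hc') (fun s => L.next_add_length s c) (fun s => L.next_add_length s c')
    (theta_add_length hc) (theta_add_length hc') (strictMono_theta hc) (theta_next hc)
    (theta_next hc') fun s => L.strictMono_next s hcc

theorem lt_next (hc : 0 < c) (s : ℝ) : s < L.next s c := by
  have := L.strictMono_next s hc
  rwa [L.next_zero] at this

/-- Near the boundary the invariant measures on the level curves approach the Lazutkin measure. -/
theorem theta_close_to_lazutkin {ε : ℝ} (hε : 0 < ε) :
    ∃ η > 0, ∀ c ∈ Ioo 0 η, ∀ s, |L.theta s c - D.lazutkin s| ≤ ε := by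
  have hl := D.length_pos
  -- `60` and `1 / 100` are the constants of `conjugacy_close_of_small_second_difference`.
  set ε' := min (ε / 60) (1 / 100) with hε'
  have hε'0 : 0 < ε' := by positivity
  obtain ⟨η₀, hη₀, h0⟩ := D.lazutkin_second_difference ε' hε'0
  obtain ⟨η₁, hη₁, hη₁c, h1⟩ := exists_uniform_small (G := fun s c => L.next s c - s) hl L.c₀_pos
    (L.continuous_next.sub continuous_fst).continuousOn
    (fun s c => by rw [L.next_add_length]; ring) (fun s => by rw [L.next_zero, sub_self]) hη₀
  obtain ⟨η₂, hη₂, hη₂c, h2⟩ := exists_uniform_small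
    (G := fun s c => D.lazutkin (L.next s c) - D.lazutkin s) hl L.c₀_pos
    ((D.continuous_lazutkin.comp L.continuous_next).sub
      (D.continuous_lazutkin.comp continuous_fst)).continuousOn
    (fun s c => by rw [L.next_add_length, D.lazutkin_add_length, D.lazutkin_add_length]; ring)
    (fun s => by rw [L.next_zero, sub_self]) hε'0
  refine ⟨min η₁ η₂, lt_min hη₁ hη₂, fun c hc s => ?_⟩
  have hcη₁ : c < η₁ := hc.2.trans_le (min_le_left _ _)
  have hcη₂ : c < η₂ := hc.2.trans_le (min_le_right _ _)
  have hc₀ : c < L.c₀ := hcη₁.trans_le hη₁c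
  have hc1 : c ∈ Ico 0 L.c₀ := ⟨hc.1.le, hc₀⟩
  have hc2 : c ∈ Icc 0 L.c₀ := ⟨hc.1.le, hc₀.le⟩
  have key := (conjugacy_close_of_small_second_difference (f := fun s => L.next s c)
    (θ := fun s => L.theta s c) (x := D.lazutkin) (ρ := L.rho c) hl hε'0 (min_le_right _ _)
    theta_zero_left D.lazutkin_zero (theta_length hc1) D.lazutkin_length (strictMono_theta hc1)
    D.strictMono_lazutkin (theta_next hc1)
    (fun s => sub_pos.2 (D.strictMono_lazutkin (lt_next hc.1 s)))
    (fun s => (le_abs_self _).trans (h2 s c ⟨hc.1.le, hcη₂.le⟩).le)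
    (fun s => h0 s (L.next s c) (L.next (L.next s c) c) (lt_next hc.1 s) (lt_next hc.1 _)
      ((le_abs_self _).trans_lt (h1 s c ⟨hc.1.le, hcη₁.le⟩))
      ((le_abs_self _).trans_lt (h1 _ c ⟨hc.1.le, hcη₁.le⟩))
      (by rw [L.angleIn_next s c hc2, L.angleOut_next _ c hc2]))).2
  have hp : Function.Periodic (fun s => L.theta s c - D.lazutkin s) D.length := fun s => by
    simp only [theta_add_length hc1, D.lazutkin_add_length]; ring
  obtain ⟨t, ht, hst⟩ := hp.exists_mem_Ico₀ hl s
  rw [hst]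
  refine (key t ⟨ht.1, ht.2.le⟩).trans ?_
  have : ε' ≤ ε / 60 := min_le_left _ _
  linarith

theorem continuousOn_mass :
    ContinuousOn (fun p : ℝ × ℝ => L.mass p.1 p.2) (univ ×ˢ Ioo 0 L.c₀) := by
  rw [continuousOn_iff_continuous_domRestrict]
  have h1 : Continuous (Function.uncurry
      fun (x : ((univ : Set ℝ) ×ˢ Ioo 0 L.c₀ : Set (ℝ × ℝ))) (t : ℝ) => L.weight t x.1.2) :=
    L.continuousOn_weight.comp_continuous
      (f := fun y : ((univ : Set ℝ) ×ˢ Ioo 0 L.c₀ : Set (ℝ × ℝ)) × ℝ => (y.2, y.1.1.2))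
      (by fun_prop) fun y => ⟨mem_univ _, y.1.2.2⟩
  exact intervalIntegral.continuous_parametric_intervalIntegral_of_continuous h1
    (continuous_fst.comp continuous_subtype_val)

/-- For `c > 0` this is continuity of integrals. At `c = 0`, where the formula changes, it is the
uniform closeness to the Lazutkin coordinate. -/
theorem continuousOn_theta :
    ContinuousOn (fun p : ℝ × ℝ => L.theta p.1 p.2) (univ ×ˢ Ico 0 L.c₀) := by
  rintro ⟨s, c⟩ ⟨-, hc⟩
  rcases hc.1.eq_or_lt with rfl | h
  · rw [ContinuousWithinAt, Metric.tendsto_nhdsWithin_nhds]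
    intro ε hε
    obtain ⟨η, hη, h1⟩ := theta_close_to_lazutkin (L := L) (half_pos hε)
    obtain ⟨η', hη', h2⟩ := Metric.continuous_iff.1 D.continuous_lazutkin s (ε / 2) (half_pos hε)
    refine ⟨min η η', lt_min hη hη', ?_⟩
    rintro ⟨t, c⟩ ⟨-, hc'⟩ hd
    rw [Prod.dist_eq, max_lt_iff] at hd
    have hx := h2 t (hd.1.trans_le (min_le_right _ _))
    have hcη : c < η := by
      have := hd.2.trans_le (min_le_left _ _)
      simp only [Real.dist_eq, sub_zero] at this
      exact (le_abs_self c).trans_lt this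
    simp only [theta_zero_right]
    have h3 : dist (L.theta t c) (D.lazutkin t) ≤ ε / 2 := by
      rcases hc'.1.eq_or_lt with h0 | h0
      · simp only at h0
        rw [← h0, theta_zero_right, dist_self]; exact (half_pos hε).le
      · exact h1 c ⟨h0, hcη⟩ t
    calc dist (L.theta t c) (D.lazutkin s) ≤ _ := dist_triangle _ (D.lazutkin t) _
      _ < ε := by linarith
  · refine ContinuousAt.continuousWithinAt ?_
    have hopen : IsOpen ((univ : Set ℝ) ×ˢ Ioo 0 L.c₀) := isOpen_univ.prod isOpen_Ioo
    have hmem : (s, c) ∈ (univ : Set ℝ) ×ˢ Ioo 0 L.c₀ := ⟨mem_univ _, h, hc.2⟩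
    have h1 := L.continuousOn_mass.div (g := fun p : ℝ × ℝ => L.mass D.length p.2)
      (L.continuousOn_mass.comp (f := fun p : ℝ × ℝ => (D.length, p.2)) (by fun_prop)
        fun p hp => ⟨mem_univ _, hp.2⟩) fun p hp => (mass_length_pos hp.2).ne'
    refine (h1.continuousAt (hopen.mem_nhds hmem)).congr ?_
    filter_upwards [hopen.mem_nhds hmem] with p hp
    exact (theta_of_pos hp.2.1 p.1).symm

theorem continuousOn_rho : ContinuousOn L.rho (Ico 0 L.c₀) :=
  continuousOn_theta.comp (f := fun c : ℝ => (L.next 0 c, c))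
    ((L.continuous_next.comp (continuous_const.prodMk continuous_id)).prodMk
      continuous_id).continuousOn fun _ hc => ⟨mem_univ _, hc⟩

theorem rho_nonneg (hc : c ∈ Ico 0 L.c₀) : 0 ≤ L.rho c := by
  rw [← rho_zero (L := L)]
  exact strictMonoOn_rho.monotoneOn ⟨le_rfl, L.c₀_pos⟩ hc hc.1

theorem rho_pos (hc : c ∈ Ioo 0 L.c₀) : 0 < L.rho c := by
  rw [← rho_zero (L := L)]
  exact strictMonoOn_rho ⟨le_rfl, L.c₀_pos⟩ (Ioo_subset_Ico_self hc) hc.1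

theorem F_congr {s t : ℝ} (h : (s : AddCircle D.length) = t) (φ : ℝ) : L.F s φ = L.F t φ := by
  have hp : Function.Periodic (fun s => L.F s φ) D.length := fun s => L.F_add_length s φ
  exact congrArg hp.lift h

theorem angle_congr {s t : ℝ} (h : (s : AddCircle D.length) = t) (c : ℝ) :
    L.angle s c = L.angle t c :=
  (L.strictMono_F s).injective (by rw [L.F_angle, F_congr h, L.F_angle])

theorem angle_zero (s : ℝ) : L.angle s 0 = 0 :=
  (L.strictMono_F s).injective (by rw [L.F_angle, L.F_zero])

theorem theta_congr (hc : c ∈ Ico 0 L.c₀) {s t : ℝ} (h : (s : AddCircle D.length) = t) :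
    (L.theta s c : AddCircle (1 : ℝ)) = L.theta t c := by
  have hp : Function.Periodic (fun s => (L.theta s c : AddCircle (1 : ℝ))) D.length := fun s => by
    simp only [theta_add_length hc, AddCircle.coe_add_period]
  exact congrArg hp.lift h

theorem theta_add_int_mul (hc : c ∈ Ico 0 L.c₀) (s : ℝ) (n : ℤ) :
    L.theta (s + n * D.length) c = L.theta s c + n := by
  have hp : Function.Periodic (fun s => L.theta s c - s / D.length) D.length := fun s => by
    simp only [theta_add_length hc, add_div, div_self D.length_pos.ne']; ring
  have := hp.int_mul n s
  simp only [add_div, mul_div_cancel_right₀ _ D.length_pos.ne'] at this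
  linarith

theorem coe_eq_of_theta_coe_eq (hc : c ∈ Ico 0 L.c₀) {s t : ℝ}
    (h : (L.theta s c : AddCircle (1 : ℝ)) = L.theta t c) : (s : AddCircle D.length) = t := by
  have h1 : ((L.theta s c - L.theta t c : ℝ) : AddCircle (1 : ℝ)) = 0 := by
    rw [AddCircle.coe_sub, h, sub_self]
  obtain ⟨n, hn⟩ := (AddCircle.coe_eq_zero_iff (1 : ℝ)).1 h1
  rw [zsmul_eq_mul, mul_one] at hn
  have h2 : s = t + n * D.length :=
    (strictMono_theta hc).injective (by
      rw [theta_add_int_mul hc, hn]; ring)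
  rw [h2, AddCircle.coe_add, ← zsmul_eq_mul, AddCircle.coe_zsmul, AddCircle.coe_period, smul_zero,
    add_zero]

theorem next_mem_Ioo (hc : c ∈ Ioc 0 L.c₀) (s : ℝ) : L.next s c ∈ Ioo s (s + D.length) :=
  ⟨lt_next hc.1 s, L.next_lt s c hc.2⟩

theorem angle_mem (hc : c ∈ Icc 0 L.c₀) (s : ℝ) : L.angle s c ∈ Icc 0 Real.pi := by
  rcases hc.1.eq_or_lt with rfl | h
  · rw [angle_zero]; exact ⟨le_rfl, Real.pi_pos.le⟩
  · rw [← L.angleOut_next s c hc]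
    exact Ioo_subset_Icc_self (angleOut_mem (next_mem_Ioo ⟨h, hc.2⟩ s))

theorem billiardMap_level (hc : c ∈ Icc 0 L.c₀) (s : ℝ) :
    D.billiardMap (D.phase s (L.angle s c)) = D.phase (L.next s c) (L.angle (L.next s c) c) := by
  rcases hc.1.eq_or_lt with rfl | h
  · rw [L.next_zero]
    refine billiardMap_of_snd_eq_zero ?_
    rw [phase_snd (angle_mem hc s), angle_zero]
  · rw [← L.angleOut_next s c hc, billiardMap_phase (next_mem_Ioo ⟨h, hc.2⟩ s),
      L.angleIn_next s c hc]

theorem angle_eq_zero_iff (s : ℝ) : L.angle s c = 0 ↔ c = 0 := by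
  constructor
  · intro h
    rw [← L.F_angle s c, h, L.F_zero]
  · rintro rfl; exact angle_zero s

end LevelFamily

theorem continuous_phase : Continuous fun x : ℝ × ℝ => D.phase x.1 x.2 :=
  (continuous_quotient_mk'.comp continuous_fst).prodMk (continuous_projIcc.comp continuous_snd)

end StrictlyConvexTable

/-! ### The twist normal form and the conjugacy. -/

namespace StrictlyConvexTable

variable {D E : StrictlyConvexTable}

/-- Near the boundary an integrable billiard map is conjugate to the twist map
`(θ, ρ) ↦ (θ + ρ, ρ)`. -/
theorem LevelFamily.exists_normalForm (L : LevelFamily D) :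
    ∃ (H : OpenPartialHomeomorph D.Phase (AddCircle (1 : ℝ) × NNReal)) (r : NNReal), 0 < r ∧
      H.target = {q | q.2 < r} ∧ (∀ p : D.Phase, (p.2 : ℝ) = 0 → p ∈ H.source) ∧
      ∀ p ∈ H.source, ((H p).2 = 0 ↔ (p.2 : ℝ) = 0) ∧ D.billiardMap p ∈ H.source ∧
        H (D.billiardMap p) = ((H p).1 + (((H p).2 : ℝ) : AddCircle (1 : ℝ)), (H p).2) := by
  have hl := D.length_pos
  have hfact := Fact.mk hl
  have hfact1 : Fact ((0 : ℝ) < 1) := ⟨one_pos⟩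
  -- `theta` and `rho` are controlled for `c < L.c₀`, and `K` has to be compact.
  set c₁ := L.c₀ / 2 with hc₁_def
  have hc₁ : 0 < c₁ := half_pos L.c₀_pos
  have hc₁₀ : c₁ < L.c₀ := half_lt_self L.c₀_pos
  have hIco : ∀ {c}, c ∈ Icc 0 c₁ → c ∈ Ico 0 L.c₀ := fun h => ⟨h.1, h.2.trans_lt hc₁₀⟩
  have hIcc : ∀ {c}, c ∈ Icc 0 c₁ → c ∈ Icc 0 L.c₀ := fun h => ⟨h.1, h.2.trans hc₁₀.le⟩
  set K : Set (ℝ × ℝ) := Icc 0 D.length ×ˢ Icc 0 c₁ with hK_def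
  -- The rectangle `K` in the variables `(s, c)` covers a collar of the phase annulus through `P`
  -- and a collar of the model through `Q`. Equal fibres of `P` and `Q` make the correspondence a
  -- homeomorphism.
  set P : ℝ × ℝ → D.Phase := fun x => D.phase x.1 (L.angle x.1 x.2) with hP_def
  set Q : ℝ × ℝ → AddCircle (1 : ℝ) × NNReal :=
    fun x => ((L.theta x.1 x.2 : AddCircle (1 : ℝ)), (L.rho x.2).toNNReal) with hQ_def
  have hPc : Continuous P := continuous_phase.comp (continuous_fst.prodMk L.continuous_angle)
  have hQc : ContinuousOn Q K := by
    refine ContinuousOn.prodMk ?_ ?_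
    · exact continuous_quotient_mk'.comp_continuousOn
        (continuousOn_theta.mono fun x hx => ⟨mem_univ _, hIco hx.2⟩)
    · exact continuous_real_toNNReal.comp_continuousOn
        (continuousOn_rho.comp continuousOn_snd fun x hx => hIco hx.2)
  have hPcoe : ∀ {s t c c'}, c ∈ Icc 0 c₁ → c' ∈ Icc 0 c₁ → P (s, c) = P (t, c') →
      (s : AddCircle D.length) = t ∧ c = c' := by
    intro s t c c' hc hc' h
    have h1 : (s : AddCircle D.length) = t := congrArg Prod.fst h
    have h2 : L.angle s c = L.angle t c' := by
      have := congrArg (fun p : D.Phase => (p.2 : ℝ)) h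
      simpa only [hP_def, phase_snd (angle_mem (hIcc hc) s), phase_snd (angle_mem (hIcc hc') t)]
        using this
    exact ⟨h1, by rw [← L.F_angle s c, h2, F_congr h1, L.F_angle]⟩
  have hPQ : ∀ {s t c c'}, c ∈ Icc 0 c₁ → c' ∈ Icc 0 c₁ → P (s, c) = P (t, c') →
      Q (s, c) = Q (t, c') := by
    intro s t c c' hc hc' h
    obtain ⟨h1, rfl⟩ := hPcoe hc hc' h
    simp only [hQ_def, theta_congr (hIco hc) h1]
  have hQP : ∀ {s t c c'}, c ∈ Icc 0 c₁ → c' ∈ Icc 0 c₁ → Q (s, c) = Q (t, c') →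
      P (s, c) = P (t, c') := by
    intro s t c c' hc hc' h
    have h1 : L.rho c = L.rho c' :=
      (Real.toNNReal_eq_toNNReal_iff (rho_nonneg (hIco hc)) (rho_nonneg (hIco hc'))).1
        (congrArg Prod.snd h)
    obtain rfl := strictMonoOn_rho.injOn (hIco hc) (hIco hc') h1
    have h2 := coe_eq_of_theta_coe_eq (hIco hc) (congrArg Prod.fst h)
    simp only [hP_def, phase, h2, angle_congr h2]
  set U : Set D.Phase := (fun x : ℝ × Icc (0 : ℝ) Real.pi => ((x.1 : AddCircle D.length), x.2)) ''
    {x | L.F x.1 x.2 < c₁} with hU_def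
  set r : NNReal := (L.rho c₁).toNNReal with hr_def
  have hr : 0 < r := Real.toNNReal_pos.2 (rho_pos ⟨hc₁, hc₁₀⟩)
  have hUopen : IsOpen U := by
    have h1 : IsOpenMap fun x : ℝ × Icc (0 : ℝ) Real.pi => ((x.1 : AddCircle D.length), x.2) :=
      (QuotientAddGroup.isOpenMap_coe).prodMap IsOpenMap.id
    refine h1 _ (isOpen_lt ?_ continuous_const)
    exact L.continuous_F.comp
      (continuous_fst.prodMk (continuous_subtype_val.comp continuous_snd))
  have hlift : ∀ p ∈ U, ∃ s ∈ Icc 0 D.length, ∃ c ∈ Ico 0 c₁, p = P (s, c) := by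
    rintro _ ⟨⟨s, φ⟩, hsφ, rfl⟩
    obtain ⟨n, hn, -⟩ := existsUnique_add_zsmul_mem_Ico hl s 0
    rw [zero_add] at hn
    have hcoe : ((s + n • D.length : ℝ) : AddCircle D.length) = s := by
      rw [AddCircle.coe_add, AddCircle.coe_zsmul, AddCircle.coe_period, smul_zero, add_zero]
    refine ⟨s + n • D.length, ⟨hn.1, hn.2.le⟩, L.F s φ, ⟨?_, hsφ⟩, ?_⟩
    · have := (L.strictMono_F s).monotone φ.2.1
      rwa [L.F_zero] at this
    · have h1 : L.angle (s + n • D.length) (L.F s φ) = φ := by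
        rw [angle_congr hcoe]
        exact (L.strictMono_F s).injective (L.F_angle _ _)
      simp only [hP_def, phase, h1, projIcc_val, hcoe]
  have hPU : ∀ s, ∀ c ∈ Icc 0 c₁, P (s, c) ∈ U ↔ c < c₁ := by
    intro s c hc
    constructor
    · intro h
      obtain ⟨t, -, c', hc', h'⟩ := hlift _ h
      rw [(hPcoe hc ⟨hc'.1, hc'.2.le⟩ h').2]; exact hc'.2
    · intro h
      refine ⟨(s, (P (s, c)).2), ?_, rfl⟩
      change L.F s (P (s, c)).2 < c₁
      rw [hP_def, phase_snd (angle_mem (hIcc hc) s), L.F_angle]; exact h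
  have hQV : ∀ s, ∀ c ∈ Icc 0 c₁, Q (s, c) ∈ {q : AddCircle (1 : ℝ) × NNReal | q.2 < r} ↔ c < c₁ := by
    intro s c hc
    change (L.rho c).toNNReal < (L.rho c₁).toNNReal ↔ _
    rw [Real.toNNReal_lt_toNNReal_iff (rho_pos ⟨hc₁, hc₁₀⟩)]
    exact strictMonoOn_rho.lt_iff_lt (hIco hc) ⟨hc₁.le, hc₁₀⟩
  have hUK : U ⊆ P '' K := fun p hp => by
    obtain ⟨s, hs, c, hc, rfl⟩ := hlift p hp
    exact ⟨(s, c), ⟨hs, hc.1, hc.2.le⟩, rfl⟩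
  have hVK : {q : AddCircle (1 : ℝ) × NNReal | q.2 < r} ⊆ Q '' K := by
    rintro ⟨x, ρ⟩ hρ
    -- Two applications of the intermediate value theorem: `ρ` determines the level `c`, then `θ`
    -- determines `s` on it.
    obtain ⟨c, hc, hcρ⟩ := intermediate_value_Icc hc₁.le
      (continuousOn_rho.mono fun c hc => hIco hc)
      (show (ρ : ℝ) ∈ Icc (L.rho 0) (L.rho c₁) from ⟨by rw [rho_zero]; exact ρ.2, by
        have : (ρ : ℝ) < r := hρ
        rw [hr_def, Real.coe_toNNReal _ (rho_nonneg ⟨hc₁.le, hc₁₀⟩)] at this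
        exact this.le⟩)
    obtain ⟨y, hy, rfl⟩ : ∃ y ∈ Icc (0 : ℝ) 1, (y : AddCircle (1 : ℝ)) = x := by
      have := AddCircle.coe_image_Icc_eq (1 : ℝ) 0
      rw [zero_add] at this
      have hx : x ∈ (QuotientAddGroup.mk : ℝ → AddCircle (1 : ℝ)) '' Icc 0 1 := by
        rw [this]; exact mem_univ x
      exact hx
    obtain ⟨s, hs, hsy⟩ := intermediate_value_Icc hl.le
      (continuous_theta_left (L := L) (hIco hc)).continuousOn
      (show y ∈ Icc (L.theta 0 c) (L.theta D.length c) by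
        rw [theta_zero_left, theta_length (hIco hc)]; exact hy)
    refine ⟨(s, c), ⟨hs, hc⟩, ?_⟩
    simp only at hsy
    simp only [hQ_def, hsy, hcρ, Real.toNNReal_coe]
  obtain ⟨H, hHs, hHt, hH⟩ := exists_openPartialHomeomorph_of_fibres (P := P) (Q := Q)
    (isCompact_Icc.prod isCompact_Icc : IsCompact K) ⟨(0, 0), ⟨le_rfl, hl.le⟩, le_rfl, hc₁.le⟩
    hPc.continuousOn hQc
    (fun a ha b hb => ⟨fun h => hPQ ha.2 hb.2 h, fun h => hQP ha.2 hb.2 h⟩) hUopen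
    (isOpen_lt continuous_snd continuous_const) hUK hVK
    (fun a ha => (hPU a.1 a.2 ha.2).trans (hQV a.1 a.2 ha.2).symm)
  -- `s` is unrestricted here, because `next s c` may leave the period `[0, D.length]`.
  have hHP : ∀ s, ∀ c ∈ Ico 0 c₁, H (P (s, c)) = Q (s, c) := by
    intro s c hc
    have hc' : c ∈ Icc 0 c₁ := ⟨hc.1, hc.2.le⟩
    obtain ⟨t, ht, c', hc'', h⟩ := hlift _ ((hPU s c hc').2 hc.2)
    obtain ⟨-, rfl⟩ := hPcoe hc' ⟨hc''.1, hc''.2.le⟩ h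
    rw [hPQ hc' hc' h, h]
    exact hH (t, c) ⟨ht, hc'⟩ ((hPU t c hc').2 hc.2)
  refine ⟨H, r, hr, hHt, fun p hp => ?_, fun p hp => ?_⟩
  · obtain ⟨s, hs⟩ := exists_lift p
    have : p = P (s, 0) := by rw [hs, hp]; simp only [hP_def, angle_zero]
    rw [hHs, this]
    exact (hPU s 0 ⟨le_rfl, hc₁.le⟩).2 hc₁
  · rw [hHs] at hp ⊢
    obtain ⟨s, -, c, hc, rfl⟩ := hlift p hp
    have hc' : c ∈ Icc 0 c₁ := ⟨hc.1, hc.2.le⟩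
    have hb : D.billiardMap (P (s, c)) = P (L.next s c, c) := billiardMap_level (hIcc hc') s
    rw [hb, hHP s c hc, hHP _ c hc]
    refine ⟨?_, (hPU _ c hc').2 hc.2, ?_⟩
    · simp only [hP_def, hQ_def, phase_snd (angle_mem (hIcc hc') s), angle_eq_zero_iff]
      rw [Real.toNNReal_eq_zero]
      constructor
      · intro h0
        by_contra hne
        exact h0.not_gt (rho_pos ⟨hc.1.lt_of_ne (Ne.symm hne), hc.2.trans hc₁₀⟩)
      · rintro rfl; exact rho_zero.le
    · simp only [hQ_def, theta_next (hIco hc'), Real.coe_toNNReal _ (rho_nonneg (hIco hc')),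
        AddCircle.coe_add]

/-- A neighbourhood of the boundary circle of the phase annulus contains a collar. -/
theorem exists_collar_subset {U : Set D.Phase} (hU : IsOpen U)
    (h : ∀ p : D.Phase, (p.2 : ℝ) = 0 → p ∈ U) :
    ∃ δ > 0, ∀ p : D.Phase, (p.2 : ℝ) ≤ δ → p ∈ U := by
  have hfact := Fact.mk D.length_pos
  rcases (Uᶜ).eq_empty_or_nonempty with he | hne
  · exact ⟨1, one_pos, fun p _ => by rw [compl_empty_iff] at he; rw [he]; exact mem_univ p⟩
  · have hc : Continuous fun p : D.Phase => (p.2 : ℝ) := continuous_subtype_val.comp continuous_snd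
    obtain ⟨q, hq, hmin⟩ := hU.isClosed_compl.isCompact.exists_isMinOn hne hc.continuousOn
    have hq0 : 0 < (q.2 : ℝ) := q.2.2.1.lt_of_ne fun h0 => hq (h q h0.symm)
    refine ⟨(q.2 : ℝ) / 2, half_pos hq0, fun p hp => ?_⟩
    by_contra hpU
    have := hmin hpU
    simp only [mem_ofPred_eq] at this
    linarith

/-- The two normal forms may have different heights `r` and `q`. Composition restricts them to the
common part `ρ < min r q`, which the twist map preserves because it fixes `ρ`. -/
theorem LevelFamily.conjugateNearBoundary (L : LevelFamily D) (M : LevelFamily E) :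
    D.ConjugateNearBoundary E := by
  obtain ⟨H, r, hr, hHt, hH0, hH⟩ := L.exists_normalForm
  obtain ⟨G, q, hq, hGt, hG0, hG⟩ := M.exists_normalForm
  set h := H.trans G.symm with hh
  have hsrc : ∀ p, p ∈ h.source ↔ p ∈ H.source ∧ (H p).2 < q := by
    intro p
    rw [hh, OpenPartialHomeomorph.trans_source, OpenPartialHomeomorph.symm_source, hGt]
    rfl
  have hb : ∀ p ∈ h.source, D.billiardMap p ∈ h.source ∧
      h (D.billiardMap p) = E.billiardMap (h p) := by
    intro p hp
    rw [hsrc] at hp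
    obtain ⟨-, h2, h3⟩ := hH p hp.1
    have hmem : H p ∈ G.target := by rw [hGt]; exact hp.2
    have hGsrc : G.symm (H p) ∈ G.source := G.map_target hmem
    obtain ⟨-, g2, g3⟩ := hG _ hGsrc
    rw [G.right_inv hmem] at g3
    refine ⟨(hsrc _).2 ⟨h2, by rw [h3]; exact hp.2⟩, ?_⟩
    change G.symm (H (D.billiardMap p)) = E.billiardMap (G.symm (H p))
    rw [h3, ← g3, G.left_inv g2]
  obtain ⟨δ, hδ, hδs⟩ := exists_collar_subset h.open_source fun p hp => by
    rw [hsrc]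
    have := hH0 p hp
    refine ⟨this, ?_⟩
    rw [(hH p this).1.2 hp]; exact hq
  refine ⟨h, δ, hδ, fun p hp => ?_, fun x hx => ?_, fun p hp => ⟨hδs p hp, hb p (hδs p hp)⟩⟩
  · rw [hsrc] at hp
    have hmem : H p ∈ G.target := by rw [hGt]; exact hp.2
    rw [← (hH p hp.1).1]
    have := (hG _ (G.map_target hmem)).1
    rw [G.right_inv hmem] at this
    exact this.symm
  · have hx' := hG0 x hx
    rw [hh, OpenPartialHomeomorph.trans_target, OpenPartialHomeomorph.symm_target]
    refine ⟨hx', ?_⟩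
    change G x ∈ H.target
    rw [hHt]
    change (G x).2 < r
    rw [(hG x hx').1.2 hx]; exact hr

theorem IntegrableNearBoundary.conjugateNearBoundary (hD : D.IntegrableNearBoundary)
    (hE : E.IntegrableNearBoundary) : D.ConjugateNearBoundary E := by
  obtain ⟨N⟩ := hD.nonempty_normalizedIntegral
  obtain ⟨N'⟩ := hE.nonempty_normalizedIntegral
  obtain ⟨L⟩ := N.nonempty_levelFamily
  obtain ⟨M⟩ := N'.nonempty_levelFamily
  exact L.conjugateNearBoundary M

end StrictlyConvexTable

/-! ### Ellipses are integrable. -/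

namespace StrictlyConvexTable

variable {D : StrictlyConvexTable}

theorem IsCircle.isEllipse (h : D.IsCircle) : D.IsEllipse 0 := by
  obtain ⟨c, R, hR, hb⟩ := h
  refine ⟨le_rfl, one_pos, c, c, R, hR, by simp, ?_⟩
  rw [hb]
  ext z
  simp only [Metric.mem_sphere, mem_ofPred_eq]
  constructor <;> intro h <;> linarith

theorem left_nonneg (s t : ℝ) : 0 ≤ ((starRingEnd ℂ) (deriv D.γ s) * (D.γ t - D.γ s)).im := by
  by_cases h : ∀ n : ℤ, t ≠ s + n * D.length
  · exact (D.strictly_left s t h).le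
  · push Not at h
    obtain ⟨n, rfl⟩ := h
    rw [D.periodic.int_mul n s, sub_self, mul_zero, Complex.zero_im]

theorem left_pos {s t : ℝ} (h : D.γ t ≠ D.γ s) :
    0 < ((starRingEnd ℂ) (deriv D.γ s) * (D.γ t - D.γ s)).im := by
  refine D.strictly_left s t fun n hn => h ?_
  rw [hn, D.periodic.int_mul n s]

/-- A point strictly between two points of the boundary lies strictly to the left of every
tangent. -/
theorem left_pos_of_between {x y : ℂ} (hx : x ∈ D.boundary) (hy : y ∈ D.boundary) (hxy : x ≠ y)
    {u v : ℝ} (hu : 0 < u) (hv : 0 < v) (huv : u + v = 1) (s : ℝ) :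
    0 < ((starRingEnd ℂ) (deriv D.γ s) * (u * x + v * y - D.γ s)).im := by
  obtain ⟨a, rfl⟩ := hx
  obtain ⟨b, rfl⟩ := hy
  have hid : (starRingEnd ℂ) (deriv D.γ s) * (u * D.γ a + v * D.γ b - D.γ s) =
      (u : ℂ) * ((starRingEnd ℂ) (deriv D.γ s) * (D.γ a - D.γ s)) +
        (v : ℂ) * ((starRingEnd ℂ) (deriv D.γ s) * (D.γ b - D.γ s)) := by
    have : (u : ℂ) + v = 1 := by exact_mod_cast huv
    linear_combination (- (starRingEnd ℂ) (deriv D.γ s) * D.γ s) * (-this)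
  rw [hid, Complex.add_im, Complex.im_ofReal_mul, Complex.im_ofReal_mul]
  by_cases ha : D.γ a = D.γ s
  · have hb : D.γ b ≠ D.γ s := fun hb => hxy (ha.trans hb.symm)
    have := mul_pos hv (left_pos hb)
    have := mul_nonneg hu.le (left_nonneg (D := D) s a)
    linarith
  · have := mul_pos hu (left_pos ha)
    have := mul_nonneg hv.le (left_nonneg (D := D) s b)
    linarith

/-- The focus lies strictly between the endpoints `x` and `y` of the major axis, with weights `(1 +
e) / 2` and `(1 - e) / 2`. The foci being interior fixes the signs in `focal_identity`. -/
theorem focus_left {p q : ℂ} {a e : ℝ} (ha : 0 < a) (he : 0 ≤ e) (he1 : e < 1)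
    (hpq : dist p q = 2 * a * e) (hb : D.boundary = {z : ℂ | dist z p + dist z q = 2 * a}) (s : ℝ) :
    0 < ((starRingEnd ℂ) (deriv D.γ s) * (p - D.γ s)).im := by
  -- `u` is the direction of the major axis; for coinciding foci any direction serves.
  obtain ⟨u, hu, hpu⟩ : ∃ u : ℂ, ‖u‖ = 1 ∧ p - q = (2 * a * e : ℝ) * u := by
    by_cases h : p = q
    · refine ⟨1, norm_one, ?_⟩
      rw [← hpq, h]; simp
    · have h0 : p - q ≠ 0 := sub_ne_zero.2 h
      have h1 : ‖p - q‖ ≠ 0 := norm_ne_zero_iff.2 h0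
      refine ⟨(p - q) / (‖p - q‖ : ℂ), ?_, ?_⟩
      · rw [norm_div, Complex.norm_real, norm_norm, div_self h1]
      · have h2 : (‖p - q‖ : ℂ) ≠ 0 := by exact_mod_cast h1
        rw [← hpq, dist_eq_norm]
        field_simp
  have hu0 : u ≠ 0 := by rintro rfl; simp at hu
  have hq : q = p - (2 * a * e : ℝ) * u := by rw [← hpu]; ring
  set x := p + (a * (1 - e) : ℝ) * u with hx
  set y := p - (a * (1 + e) : ℝ) * u with hy
  have hnorm : ∀ r : ℝ, ‖(r : ℂ) * u‖ = |r| := fun r => by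
    rw [norm_mul, hu, mul_one, Complex.norm_real, Real.norm_eq_abs]
  have h1e : 0 < a * (1 - e) := mul_pos ha (by linarith)
  have h1e' : 0 < a * (1 + e) := mul_pos ha (by linarith)
  have hxb : x ∈ D.boundary := by
    rw [hb, mem_ofPred_eq, dist_eq_norm, dist_eq_norm]
    have e1 : x - p = (a * (1 - e) : ℝ) * u := by rw [hx]; ring
    have e2 : x - q = (a * (1 + e) : ℝ) * u := by rw [hx, hq]; push_cast; ring
    rw [e1, e2, hnorm, hnorm, abs_of_pos h1e, abs_of_pos h1e']; ring
  have hyb : y ∈ D.boundary := by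
    rw [hb, mem_ofPred_eq, dist_eq_norm, dist_eq_norm]
    have e1 : y - p = (-(a * (1 + e)) : ℝ) * u := by rw [hy]; push_cast; ring
    have e2 : y - q = (-(a * (1 - e)) : ℝ) * u := by rw [hy, hq]; push_cast; ring
    rw [e1, e2, hnorm, hnorm, abs_neg, abs_neg, abs_of_pos h1e, abs_of_pos h1e']; ring
  have hxy : x ≠ y := by
    intro h
    have : ((2 * a : ℝ) : ℂ) * u = 0 := by
      have h2 := sub_eq_zero.2 h
      rw [← h2, hx, hy]; push_cast; ring
    have h2a : ((2 * a : ℝ) : ℂ) ≠ 0 := by exact_mod_cast (by positivity : (2 * a : ℝ) ≠ 0)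
    exact mul_ne_zero h2a hu0 this
  have hp : ((((1 + e) / 2 : ℝ)) : ℂ) * x + (((1 - e) / 2 : ℝ) : ℂ) * y = p := by
    rw [hx, hy]; push_cast; ring
  have := left_pos_of_between hxb hyb hxy (u := (1 + e) / 2) (v := (1 - e) / 2) (by linarith)
    (by linarith) (by ring) s
  rwa [hp] at this

/-- The focal chords of an ellipse make equal angles with the tangent, and the product of the
distances of the foci from a line that meets the tangent at the angle `φ` at the point of tangency
is `b² - r₁ r₂ sin² φ`. -/
theorem focal_identity {x₁ y₁ x₂ y₂ r₁ r₂ a c C S : ℝ} (hr₁ : 0 < r₁) (hr₂ : 0 < r₂)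
    (h₁ : x₁ ^ 2 + y₁ ^ 2 = r₁ ^ 2) (h₂ : x₂ ^ 2 + y₂ ^ 2 = r₂ ^ 2) (hy₁ : y₁ < 0) (hy₂ : y₂ < 0)
    (ht : x₁ * r₂ + x₂ * r₁ = 0) (hsum : r₁ + r₂ = 2 * a)
    (hc : (x₁ - x₂) ^ 2 + (y₁ - y₂) ^ 2 = (2 * c) ^ 2) (hCS : S ^ 2 + C ^ 2 = 1) :
    (x₁ * S - y₁ * C) * (x₂ * S - y₂ * C) = a ^ 2 - c ^ 2 - r₁ * r₂ * S ^ 2 := by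
  -- The unit vectors of the two focal chords have opposite tangential components, hence equal
  -- normal components up to sign; the signs agree since both foci lie on the same side. They are
  -- therefore `(m, n)` and `(-m, n)`.
  have hy : y₁ * r₂ = y₂ * r₁ := by
    have hsq : (-(y₁ * r₂)) ^ 2 = (-(y₂ * r₁)) ^ 2 := by
      linear_combination r₂ ^ 2 * h₁ - r₁ ^ 2 * h₂ - (x₁ * r₂ - x₂ * r₁) * ht
    have h3 : 0 ≤ -(y₁ * r₂) := by nlinarith
    have h4 : 0 ≤ -(y₂ * r₁) := by nlinarith
    have := (sq_eq_sq₀ h3 h4).1 hsq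
    linarith
  obtain ⟨m, rfl⟩ : ∃ m, x₁ = r₁ * m := ⟨x₁ / r₁, by field_simp⟩
  obtain ⟨n, rfl⟩ : ∃ n, y₁ = r₁ * n := ⟨y₁ / r₁, by field_simp⟩
  have hx₂ : x₂ = -(r₂ * m) := mul_right_cancel₀ hr₁.ne' (by linear_combination ht)
  have hy₂' : y₂ = r₂ * n := mul_right_cancel₀ hr₁.ne' (by linear_combination -hy)
  have hmn : m ^ 2 + n ^ 2 = 1 :=
    mul_left_cancel₀ (pow_pos hr₁ 2).ne' (by linear_combination h₁)
  subst hx₂ hy₂'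
  have ha : a = (r₁ + r₂) / 2 := by linarith
  subst ha
  have hc' : c ^ 2 = ((r₁ + r₂) ^ 2 * m ^ 2 + (r₁ - r₂) ^ 2 * n ^ 2) / 4 := by
    linear_combination (-1 / 4) * hc
  rw [hc']
  linear_combination (r₁ * r₂ * n ^ 2) * hCS + ((r₁ + r₂) ^ 2 / 4 - r₁ * r₂ * S ^ 2) * hmn

/-- Along a chord the angular momentum about each focus is constant. At either endpoint their
product is `b² - r₁ r₂ sin² φ`, which is even in `φ` and so survives the reflection. -/
theorem IsEllipse.integrableNearBoundary {e : ℝ} (h : D.IsEllipse e) :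
    D.IntegrableNearBoundary := by
  obtain ⟨he, he1, p, q, a, ha, hpq, hb⟩ := h
  have hp : ∀ s, 0 < ((starRingEnd ℂ) (deriv D.γ s) * (p - D.γ s)).im :=
    focus_left ha he he1 hpq hb
  have hq : ∀ s, 0 < ((starRingEnd ℂ) (deriv D.γ s) * (q - D.γ s)).im :=
    focus_left ha he he1 (by rwa [dist_comm]) (by
      rw [hb]; ext z; simp only [mem_ofPred_eq]; rw [add_comm])
  have hp0 : ∀ s, D.γ s - p ≠ 0 := fun s h => by
    have := hp s
    rw [← neg_sub, h] at this; simp at this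
  have hq0 : ∀ s, D.γ s - q ≠ 0 := fun s h => by
    have := hq s
    rw [← neg_sub, h] at this; simp at this
  have hsum : ∀ s, ‖D.γ s - p‖ + ‖D.γ s - q‖ = 2 * a := fun s => by
    have : D.γ s ∈ D.boundary := ⟨s, rfl⟩
    rw [hb, mem_ofPred_eq, dist_eq_norm, dist_eq_norm] at this
    exact this
  have hγ : Differentiable ℝ D.γ := D.contDiff.differentiable (by norm_num)
  have hder : ∀ (w : ℂ) (s : ℝ), D.γ s - w ≠ 0 →
      ∃ d, HasDerivAt (fun s => ‖D.γ s - w‖) d s ∧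
        ((D.γ s - w) * (starRingEnd ℂ) (deriv D.γ s)).re = ‖D.γ s - w‖ * d := by
    intro w s hw
    have h1 : DifferentiableAt ℝ (fun s => ‖D.γ s - w‖) s :=
      ((hγ s).sub_const w).norm ℝ hw
    refine ⟨_, h1.hasDerivAt, ?_⟩
    have h2 := h1.hasDerivAt.pow 2
    have h3 := ((D.hasDerivAt s).sub_const w).norm_sq
    have h4 := h2.unique h3
    rw [Complex.inner] at h4
    simp only [Nat.cast_ofNat, Complex.mul_re, Complex.conj_re, Complex.conj_im, Complex.sub_re,
      Complex.sub_im] at h4 ⊢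
    norm_num at h4
    linear_combination (-1 / 2) * h4
  -- The reflection property of the foci: the derivative of the constant `r₁ + r₂`.
  have htan : ∀ s, ((D.γ s - p) * (starRingEnd ℂ) (deriv D.γ s)).re * ‖D.γ s - q‖ +
      ((D.γ s - q) * (starRingEnd ℂ) (deriv D.γ s)).re * ‖D.γ s - p‖ = 0 := by
    intro s
    obtain ⟨d₁, h1, e1⟩ := hder p s (hp0 s)
    obtain ⟨d₂, h2, e2⟩ := hder q s (hq0 s)
    have h3 := h1.add h2
    have h4 : (fun s => ‖D.γ s - p‖) + (fun s => ‖D.γ s - q‖) = fun _ => 2 * a := funext hsum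
    rw [h4] at h3
    have h5 : d₁ + d₂ = 0 := h3.unique (hasDerivAt_const s (2 * a))
    rw [e1, e2]
    linear_combination (‖D.γ s - p‖ * ‖D.γ s - q‖) * h5
  have hnsq : ∀ (w : ℂ) (s : ℝ), ((D.γ s - w) * (starRingEnd ℂ) (deriv D.γ s)).re ^ 2 +
      ((D.γ s - w) * (starRingEnd ℂ) (deriv D.γ s)).im ^ 2 = ‖D.γ s - w‖ ^ 2 := by
    intro w s
    have h1 : ‖(D.γ s - w) * (starRingEnd ℂ) (deriv D.γ s)‖ = ‖D.γ s - w‖ := by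
      rw [norm_mul, RCLike.norm_conj, D.unit_speed, mul_one]
    rw [← h1, ← Complex.normSq_eq_norm_sq, Complex.normSq_apply]; ring
  have key : ∀ s ψ : ℝ,
      ((starRingEnd ℂ) (D.γ s - p) * (Complex.exp (ψ * Complex.I) * deriv D.γ s)).im *
      ((starRingEnd ℂ) (D.γ s - q) * (Complex.exp (ψ * Complex.I) * deriv D.γ s)).im =
        a ^ 2 - (a * e) ^ 2 - ‖D.γ s - p‖ * ‖D.γ s - q‖ * Real.sin ψ ^ 2 := by
    intro s ψ
    have hneg : ∀ w : ℂ, 0 < ((starRingEnd ℂ) (deriv D.γ s) * (w - D.γ s)).im →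
        ((D.γ s - w) * (starRingEnd ℂ) (deriv D.γ s)).im < 0 := by
      intro w hw
      rw [← neg_sub, mul_neg, Complex.neg_im, mul_comm] at hw
      linarith
    have hc : (((D.γ s - p) * (starRingEnd ℂ) (deriv D.γ s)).re -
        ((D.γ s - q) * (starRingEnd ℂ) (deriv D.γ s)).re) ^ 2 +
        (((D.γ s - p) * (starRingEnd ℂ) (deriv D.γ s)).im -
        ((D.γ s - q) * (starRingEnd ℂ) (deriv D.γ s)).im) ^ 2 = (2 * (a * e)) ^ 2 := by
      have h1 : ‖(D.γ s - p) * (starRingEnd ℂ) (deriv D.γ s) -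
          (D.γ s - q) * (starRingEnd ℂ) (deriv D.γ s)‖ = 2 * (a * e) := by
        rw [← sub_mul, sub_sub_sub_cancel_left, norm_mul, RCLike.norm_conj, D.unit_speed, mul_one,
          ← dist_eq_norm, dist_comm, hpq]; ring
      rw [← h1, ← Complex.normSq_eq_norm_sq, Complex.normSq_apply, Complex.sub_re, Complex.sub_im]
      ring
    have := focal_identity (norm_pos_iff.2 (hp0 s)) (norm_pos_iff.2 (hq0 s)) (hnsq p s) (hnsq q s)
      (hneg p (hp s)) (hneg q (hq s)) (htan s) (hsum s) hc (Real.sin_sq_add_cos_sq ψ)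
    rw [← this]
    have him : ∀ w : ℂ, ((starRingEnd ℂ) (D.γ s - w) * (Complex.exp (ψ * Complex.I) * deriv D.γ s)).im
        = ((D.γ s - w) * (starRingEnd ℂ) (deriv D.γ s)).re * Real.sin ψ -
          ((D.γ s - w) * (starRingEnd ℂ) (deriv D.γ s)).im * Real.cos ψ := by
      intro w
      rw [Complex.exp_mul_I, ← Complex.ofReal_cos, ← Complex.ofReal_sin]
      simp only [Complex.mul_im, Complex.mul_re, Complex.conj_re, Complex.conj_im, Complex.add_re,
        Complex.add_im, Complex.ofReal_re, Complex.ofReal_im, Complex.I_re, Complex.I_im]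
      ring
    rw [him, him]
  have hR : ∀ s, 0 < ‖D.γ s - p‖ * ‖D.γ s - q‖ := fun s =>
    mul_pos (norm_pos_iff.2 (hp0 s)) (norm_pos_iff.2 (hq0 s))
  have hsmooth : ContDiff ℝ 1
      fun x : ℝ × ℝ => ‖D.γ x.1 - p‖ * ‖D.γ x.1 - q‖ * Real.sin x.2 ^ 2 := by
    have h1 : ContDiff ℝ 1 fun x : ℝ × ℝ => D.γ x.1 :=
      (D.contDiff.of_le (by norm_num)).comp contDiff_fst
    have h2 : ContDiff ℝ 1 fun x : ℝ × ℝ => ‖D.γ x.1 - p‖ :=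
      (h1.sub contDiff_const).norm ℝ fun x => hp0 x.1
    have h3 : ContDiff ℝ 1 fun x : ℝ × ℝ => ‖D.γ x.1 - q‖ :=
      (h1.sub contDiff_const).norm ℝ fun x => hq0 x.1
    exact (h2.mul h3).mul ((Real.contDiff_sin.comp contDiff_snd).pow 2)
  -- Below `π / 2` the derivative of `sin²` is positive.
  refine ⟨Real.pi / 2, fun x => ‖D.γ x.1 - p‖ * ‖D.γ x.1 - q‖ * Real.sin x.2 ^ 2, by positivity,
    by linarith [Real.pi_pos], fun s φ => by simp only [D.periodic s],
    hsmooth.continuous.continuousOn, hsmooth.contDiffOn, fun s φ h0 h1 => ?_, fun s => by simp,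
    fun s t φ φ' _ _ hst => ?_⟩
  · have h2 : HasDerivAt (fun ψ => ‖D.γ s - p‖ * ‖D.γ s - q‖ * Real.sin ψ ^ 2)
        (‖D.γ s - p‖ * ‖D.γ s - q‖ * (2 * Real.sin φ * Real.cos φ)) φ := by
      have := ((Real.hasDerivAt_sin φ).pow 2).const_mul (‖D.γ s - p‖ * ‖D.γ s - q‖)
      simpa using this
    simp only [h2.deriv]
    have hs := Real.sin_pos_of_pos_of_lt_pi h0 (by linarith [Real.pi_pos])
    have hcos := Real.cos_pos_of_mem_Ioo ⟨by linarith [Real.pi_pos], h1⟩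
    have := hR s
    positivity
  · rw [billiardMap] at hst
    split_ifs at hst with hcond
    · have hB := hcond.2.choose_spec
      rw [hst] at hB
      obtain ⟨r, hr, h1, h2⟩ := hB
      simp only [point_coe, tangent_coe] at h1 h2
      -- The direction of the chord, read at both of its ends.
      have hv : Complex.exp ((φ : ℝ) * Complex.I) * deriv D.γ s =
          Complex.exp (((-(φ' : ℝ) : ℝ)) * Complex.I) * deriv D.γ t := by
        have h3 : (r : ℂ) ≠ 0 := by exact_mod_cast hr.ne'
        have := mul_left_cancel₀ h3 (h1.symm.trans h2)
        rw [this]; congr 2; push_cast; ring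
      have hcross : ∀ w : ℂ,
          ((starRingEnd ℂ) (D.γ t - w) * (Complex.exp ((φ : ℝ) * Complex.I) * deriv D.γ s)).im =
          ((starRingEnd ℂ) (D.γ s - w) * (Complex.exp ((φ : ℝ) * Complex.I) * deriv D.γ s)).im := by
        intro w
        have h3 : D.γ t - w = (D.γ s - w) +
            r * (Complex.exp ((φ : ℝ) * Complex.I) * deriv D.γ s) := by rw [← h1]; ring
        have h4 : ∀ v : ℂ, ((starRingEnd ℂ) v * v).im = 0 := fun v => by
          rw [mul_comm, Complex.mul_conj, Complex.ofReal_im]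
        rw [h3, map_add, map_mul _ (r : ℂ), Complex.conj_ofReal, add_mul, Complex.add_im, mul_assoc,
          Complex.im_ofReal_mul, h4, mul_zero, add_zero]
      have k1 := key s φ
      have k2 := key t (-(φ' : ℝ))
      rw [← hv, hcross, hcross, k1, Real.sin_neg, neg_sq] at k2
      simp only
      linarith
    -- The default branch, in which `billiardMap` is the identity.
    · have h1 : D.γ s = D.γ t := by
        have h0 : (s : AddCircle D.length) = t := congrArg Prod.fst hst
        rw [← point_coe, ← point_coe, h0]
      have h2 : φ = φ' := congrArg Prod.snd hst
      simp only [h1, h2]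

end StrictlyConvexTable

theorem proposition3p2 :
    (∀ D E : StrictlyConvexTable, ∀ e : ℝ, D.IsCircle → E.IsEllipse e → e ≠ 0 →
      D.ConjugateNearBoundary E) ∧
    (∀ D E : StrictlyConvexTable, ∀ e₁ e₂ : ℝ, D.IsEllipse e₁ → E.IsEllipse e₂ → e₁ ≠ e₂ →
      D.ConjugateNearBoundary E) ∧
    (∀ D E : StrictlyConvexTable, D.IntegrableNearBoundary → E.IntegrableNearBoundary →
      D.ConjugateNearBoundary E) :=
  ⟨fun _ _ _ hD hE _ => hD.isEllipse.integrableNearBoundary.conjugateNearBoundary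
    hE.integrableNearBoundary,
   fun _ _ _ _ hD hE _ => hD.integrableNearBoundary.conjugateNearBoundary
    hE.integrableNearBoundary,
   fun _ _ hD hE => hD.conjugateNearBoundary hE⟩
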